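/- Let $n\ge 1$. $Q(x_0,\ell)$ denotes the cube in $\mathbb R^n$ with centre $x_0$, side length $\ell>0$ and sides parallel to the axes, and $2Q(x_0,\ell):=Q(x_0,2\sqrt n\,\ell)$. A weight is a non-negative locally integrable function on $\mathbb R^n$; for a weight $w$ put $w(E)=\int_E w\,dx$. Write $w\in\Delta_2$ if there is $C<\infty$ with $w(2Q)\le C\,w(Q)$ for all cubes $Q$. For $1<s<\infty$, $w\in A_s$ means that $w>0$ a.e. and $\sup_Q\big(\frac1{|Q|}\int_Q w\big)^{1/s}\big(\frac1{|Q|}\int_Q w^{-s'/s}\big)^{1/s'}<\infty$, where $s'=s/(s-1)$; and $A_\infty=\bigcup_{1<s<\infty}A_s$. $\mathrm{BMO}(\mathbb R^n)$ is the set of locally integrable $b$ with $\sup_Q\frac1{|Q|}\int_Q|b-b_Q|\,dx<\infty$, $b_Q=\frac1{|Q|}\int_Q b$. Functions are real-valued throughout, or complex-valued throughout. For a function $\mathcal A$ on $[0,\infty)$, extended by $\mathcal A(\infty)=\infty$, let $\|h\|_{\mathcal A,Q}=\inf\{\lambda>0:\frac1{|Q|}\int_Q\mathcal A(|h|/\lambda)\,dx\le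 1\}$. Let $\|f\|_{L^p(\nu)}=\big(\int|f|^p\nu\,dx\big)^{1/p}$ and $\|g\|_{WL^p(w)}=\sup_{\sigma>0}\sigma\,w(\{|g|>\sigma\})^{1/p}$. For $1<p\le\alpha<q\le\infty$ and weights $\nu,w,\mu$, let $(L^p,L^q)^\alpha(\nu,w;\mu)$ be the space of locally integrable $f$ with $$\|f\|_{(L^p,L^q)^\alpha(\nu,w;\mu)}:=\sup_{\ell>0}\Big\|\,y\mapsto w(Q(y,\ell))^{1/\alpha-1/p-1/q}\,\|f\chi_{Q(y,\ell)}\|_{L^p(\nu)}\Big\|_{L^q(\mu)}<\infty,$$ and $(WL^p,L^q)^\alpha(w;\mu)$ the space of measurable $g$ with $$\|g\|_{(WL^p,L^q)^\alpha(w;\mu)}:=\sup_{\ell>0}\Big\|\,y\mapsto w(Q(y,\ell))^{1/\alpha-1/p-1/q}\,\|g\chi_{Q(y,\ell)}\|_{WL^p(w)}\Big\|_{L^q(\mu)}<\infty$$ (with $1/q=0$ and the essential supremum with respect to $\mu\,dx$ if $q=\infty$). **Theorem.** Let $1<p\le\alpha<q\le\infty$, $\mu\in\Delta_2$, $b\in\mathrm{BMO}(\mathbb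 R^n)$, $w\in A_\infty$, and let $\nu$ be a weight. Assume that for some $r>1$ there is $C<\infty$ such that for all cubes $Q$ $$\Big(\frac1{|Q|}\int_Q w(x)^r\,dx\Big)^{1/(rp)}\big\|\nu^{-1/p}\big\|_{\mathcal A,Q}\le C,\qquad \mathcal A(t)=t^{p'}[\log(e+t)]^{p'},\quad p'=\frac p{p-1}$$ (where $\nu^{-1/p}=\infty$ at the zeros of $\nu$). Let $D$ be a linear space of locally integrable functions containing all integrable functions with compact support, and let $[b,\mathcal T]$ be a linear or sublinear operator from $D$ to the measurable functions (that is, a.e., $|[b,\mathcal T](f+g)|\le|[b,\mathcal T]f|+|[b,\mathcal T]g|$ and $|[b,\mathcal T](cf)|=|c|\,|[b,\mathcal T]f|$) satisfying, with a constant $c_3$ independent of $f$ and $x$, the size condition $$\big|[b,\mathcal T](f)(x)\big|\le c_3\int_{\mathbb R^n}\frac{|b(x)-b(y)|\,|f(y)|}{|x-y|^n}\,dy\qquad\text{for } f\in D \text{ and a.e. } x\notin\operatorname{supp}f,$$ and, with a constant $C$ independent of $f$ and $\sigma$, the weak-type inequality $$w\big(\{x:|[b,\mathcal T](f)(x)|>\sigma\}\big)\le\frac{C}{\sigma^p}\int_{\mathbb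 R^n}|f(x)|^p\nu(x)\,dx\qquad\text{for } f\in D,\ \sigma>0 .$$ (The right-hand sides may be infinite.) Then there is a constant $C<\infty$ such that for every $f\in D\cap(L^p,L^q)^\alpha(\nu,w;\mu)$ one has $[b,\mathcal T]f\in(WL^p,L^q)^\alpha(w;\mu)$ and $$\big\|[b,\mathcal T]f\big\|_{(WL^p,L^q)^\alpha(w;\mu)}\le C\,\|f\|_{(L^p,L^q)^\alpha(\nu,w;\mu)} .$$ In particular, if $(L^p,L^q)^\alpha(\nu,w;\mu)\subset D$, then $[b,\mathcal T]$ is bounded from $(L^p,L^q)^\alpha(\nu,w;\mu)$ into $(WL^p,L^q)^\alpha(w;\mu)$. -/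

import Mathlib

open MeasureTheory Set
open scoped ENNReal NNReal

noncomputable section

/-- The closed cube `Q(x₀, ℓ)` in `ℝⁿ` with centre `x₀`, side length `ℓ` and sides parallel to the
coordinate axes. -/
def cube {n : ℕ} (x₀ : EuclideanSpace ℝ (Fin n)) (ℓ : ℝ) : Set (EuclideanSpace ℝ (Fin n)) :=
  {x | ∀ i, |x i - x₀ i| ≤ ℓ / 2}

/-- A weight: a non-negative locally integrable function. -/
def IsWeight {n : ℕ} (w : EuclideanSpace ℝ (Fin n) → ℝ≥0) : Prop :=
  LocallyIntegrable (fun x => (w x : ℝ)) volume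

/-- The measure `w(x) dx`. -/
def weightMeasure {n : ℕ} (w : EuclideanSpace ℝ (Fin n) → ℝ≥0) :
    Measure (EuclideanSpace ℝ (Fin n)) :=
  volume.withDensity fun x => (w x : ℝ≥0∞)

/-- The doubling class `Δ₂`: `w(2Q) ≤ C w(Q)` for all cubes `Q = Q(x₀, ℓ)`, where
`2Q = Q(x₀, 2 √n ℓ)`. -/
def IsDoublingWeight {n : ℕ} (w : EuclideanSpace ℝ (Fin n) → ℝ≥0) : Prop :=
  IsWeight w ∧ ∃ C : ℝ≥0, ∀ (x₀ : EuclideanSpace ℝ (Fin n)) (ℓ : ℝ), 0 < ℓ →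
    weightMeasure w (cube x₀ (2 * √(n : ℝ) * ℓ)) ≤ C * weightMeasure w (cube x₀ ℓ)

/-- The Muckenhoupt class `A_s`, `1 < s < ∞`. Almost everywhere positivity only excludes the
weight that vanishes almost everywhere (for which the condition would read `0 * ∞`). -/
def IsMuckenhouptWeight {n : ℕ} (s : ℝ) (w : EuclideanSpace ℝ (Fin n) → ℝ≥0) : Prop :=
  IsWeight w ∧ (∀ᵐ x, 0 < w x) ∧
    ∃ C : ℝ≥0, ∀ (x₀ : EuclideanSpace ℝ (Fin n)) (ℓ : ℝ), 0 < ℓ →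
      (⨍⁻ x in cube x₀ ℓ, (w x : ℝ≥0∞) ∂volume) ^ (1 / s) *
        (⨍⁻ x in cube x₀ ℓ, (w x : ℝ≥0∞) ^ (-(s.conjExponent / s)) ∂volume) ^ (1 / s.conjExponent) ≤ C

/-- `A_∞`, the union of the classes `A_s` over `1 < s < ∞`. -/
def IsAInftyWeight {n : ℕ} (w : EuclideanSpace ℝ (Fin n) → ℝ≥0) : Prop :=
  ∃ s : ℝ, 1 < s ∧ IsMuckenhouptWeight s w

/-- `BMO(ℝⁿ)`. -/
def IsBMO {n : ℕ} {𝕜 : Type*} [RCLike 𝕜] (b : EuclideanSpace ℝ (Fin n) → 𝕜) : Prop :=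
  LocallyIntegrable b volume ∧
    ∃ C : ℝ≥0, ∀ (x₀ : EuclideanSpace ℝ (Fin n)) (ℓ : ℝ), 0 < ℓ →
      ⨍⁻ x in cube x₀ ℓ, ‖b x - ⨍ y in cube x₀ ℓ, b y‖ₑ ∂volume ≤ C

/-- The Luxemburg norm `‖h‖_{Φ,Q} = inf {t > 0 : |Q|⁻¹ ∫_Q Φ(h / t) ≤ 1}` of a non-negative
(possibly infinite) function `h`; the infimum of the empty set is `∞`. -/
def luxemburgNorm {n : ℕ} (Φ : ℝ≥0∞ → ℝ≥0∞) (h : EuclideanSpace ℝ (Fin n) → ℝ≥0∞)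
    (Q : Set (EuclideanSpace ℝ (Fin n))) : ℝ≥0∞ :=
  ⨅ (t : ℝ≥0) (_ : 0 < t ∧ ⨍⁻ x in Q, Φ (h x / t) ∂volume ≤ 1), (t : ℝ≥0∞)

/-- The Young function `t ↦ t ^ s * (log (e + t)) ^ s`, with value `∞` at `∞`. -/
def powLogYoung (s : ℝ) (t : ℝ≥0∞) : ℝ≥0∞ :=
  t ^ s * ENNReal.ofReal (Real.log (Real.exp 1 + t.toReal)) ^ s

/-- The bump condition with exponent `r` on the pair `(w, ν)`:
`(|Q|⁻¹ ∫_Q w ^ r ∂volume) ^ (1 / (r p)) * ‖ν ^ (-1 / p)‖_{𝒜,Q} ≤ C < ∞` for all cubes `Q`, with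
`𝒜(t) = t ^ p' * (log (e + t)) ^ p'`. Here `ν ^ (-1 / p) = ∞` where `ν = 0`. -/
def OrliczBump {n : ℕ} (p r : ℝ) (w ν : EuclideanSpace ℝ (Fin n) → ℝ≥0) : Prop :=
  ∃ C : ℝ≥0, ∀ (x₀ : EuclideanSpace ℝ (Fin n)) (ℓ : ℝ), 0 < ℓ →
    (⨍⁻ x in cube x₀ ℓ, (w x : ℝ≥0∞) ^ r ∂volume) ^ (1 / (r * p)) *
      luxemburgNorm (powLogYoung p.conjExponent) (fun x => (ν x : ℝ≥0∞) ^ (-(1 / p)))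
        (cube x₀ ℓ) ≤ C

/-- The (quasi-)norm of `WL^p(w)`. -/
def weakLpNorm {n : ℕ} {𝕜 : Type*} [RCLike 𝕜] (p : ℝ) (w : EuclideanSpace ℝ (Fin n) → ℝ≥0)
    (g : EuclideanSpace ℝ (Fin n) → 𝕜) : ℝ≥0∞ :=
  ⨆ (σ : ℝ≥0) (_ : 0 < σ), σ * weightMeasure w {x | σ < ‖g x‖₊} ^ (1 / p)

/-- The norm of the weighted amalgam space `(L^p, L^q)^α(ν, w; μ)`; `q = ∞` is allowed. -/
def amalgamNorm {n : ℕ} {𝕜 : Type*} [RCLike 𝕜] (p : ℝ) (q : ℝ≥0∞) (α : ℝ)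
    (ν w μ : EuclideanSpace ℝ (Fin n) → ℝ≥0) (f : EuclideanSpace ℝ (Fin n) → 𝕜) : ℝ≥0∞ :=
  ⨆ (ℓ : ℝ) (_ : 0 < ℓ), eLpNorm
    (fun y => weightMeasure w (cube y ℓ) ^ (1 / α - 1 / p - q⁻¹.toReal) *
      eLpNorm ((cube y ℓ).indicator f) (ENNReal.ofReal p) (weightMeasure ν))
    q (weightMeasure μ)

/-- The space `(L^p, L^q)^α(ν, w; μ)`. -/
def MemAmalgam {n : ℕ} {𝕜 : Type*} [RCLike 𝕜] (p : ℝ) (q : ℝ≥0∞) (α : ℝ)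
    (ν w μ : EuclideanSpace ℝ (Fin n) → ℝ≥0) (f : EuclideanSpace ℝ (Fin n) → 𝕜) : Prop :=
  LocallyIntegrable f volume ∧ amalgamNorm p q α ν w μ f < ∞

/-- The norm of the weighted weak amalgam space `(WL^p, L^q)^α(w; μ)`. -/
def weakAmalgamNorm {n : ℕ} {𝕜 : Type*} [RCLike 𝕜] (p : ℝ) (q : ℝ≥0∞) (α : ℝ)
    (w μ : EuclideanSpace ℝ (Fin n) → ℝ≥0) (g : EuclideanSpace ℝ (Fin n) → 𝕜) : ℝ≥0∞ :=
  ⨆ (ℓ : ℝ) (_ : 0 < ℓ), eLpNorm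
    (fun y => weightMeasure w (cube y ℓ) ^ (1 / α - 1 / p - q⁻¹.toReal) *
      weakLpNorm p w ((cube y ℓ).indicator g))
    q (weightMeasure μ)

/-- The space `(WL^p, L^q)^α(w; μ)`. -/
def MemWeakAmalgam {n : ℕ} {𝕜 : Type*} [RCLike 𝕜] (p : ℝ) (q : ℝ≥0∞) (α : ℝ)
    (w μ : EuclideanSpace ℝ (Fin n) → ℝ≥0) (g : EuclideanSpace ℝ (Fin n) → 𝕜) : Prop :=
  AEStronglyMeasurable g volume ∧ weakAmalgamNorm p q α w μ g < ∞

/-- `T` is a sublinear operator (every linear one is) from the space of functions `D` to the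
measurable functions. -/
structure IsSublinearOn {n : ℕ} {𝕜 : Type*} [RCLike 𝕜]
    (D : Submodule 𝕜 (EuclideanSpace ℝ (Fin n) → 𝕜))
    (T : (EuclideanSpace ℝ (Fin n) → 𝕜) → EuclideanSpace ℝ (Fin n) → 𝕜) : Prop where
  aestronglyMeasurable : ∀ f ∈ D, AEStronglyMeasurable (T f) volume
  norm_add_le : ∀ f ∈ D, ∀ g ∈ D, ∀ᵐ x, ‖T (f + g) x‖ ≤ ‖T f x‖ + ‖T g x‖
  norm_smul : ∀ (c : 𝕜), ∀ f ∈ D, ∀ᵐ x, ‖T (c • f) x‖ = ‖c‖ * ‖T f x‖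

/-- The size condition on a commutator `T = [b, 𝒯]` with domain `D`: for `f ∈ D` and (almost every)
`x ∉ supp f`, `|T f (x)| ≤ c ∫ |b(x) - b(y)| |f(y)| / |x - y| ^ n dy`; the integral may be `∞`. -/
def CommutatorSizeCondition {n : ℕ} {𝕜 : Type*} [RCLike 𝕜]
    (D : Submodule 𝕜 (EuclideanSpace ℝ (Fin n) → 𝕜)) (b : EuclideanSpace ℝ (Fin n) → 𝕜)
    (T : (EuclideanSpace ℝ (Fin n) → 𝕜) → EuclideanSpace ℝ (Fin n) → 𝕜) : Prop :=
  ∃ c : ℝ≥0, ∀ f ∈ D, ∀ᵐ x, x ∉ tsupport f →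
    ‖T f x‖ₑ ≤ c * ∫⁻ y, ‖b x - b y‖ₑ * ‖f y‖ₑ / ‖x - y‖ₑ ^ n

/-- The two-weight weak type `(p, p)` inequality for `T` on its domain `D`. -/
def WeakTypeBound {n : ℕ} {𝕜 : Type*} [RCLike 𝕜]
    (D : Submodule 𝕜 (EuclideanSpace ℝ (Fin n) → 𝕜)) (p : ℝ)
    (w ν : EuclideanSpace ℝ (Fin n) → ℝ≥0)
    (T : (EuclideanSpace ℝ (Fin n) → 𝕜) → EuclideanSpace ℝ (Fin n) → 𝕜) : Prop :=
  ∃ C : ℝ≥0, ∀ f ∈ D, ∀ σ : ℝ≥0, 0 < σ →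
    weightMeasure w {x | σ < ‖T f x‖₊} ≤
      C / (σ : ℝ≥0∞) ^ p * ∫⁻ x, ‖f x‖ₑ ^ p * (ν x : ℝ≥0∞)

end

/-! ### Geometry of cubes, averages and Lebesgue differentiation. -/

section CubeGeometry

open Filter Topology

variable {n : ℕ} {𝕜 : Type*} [RCLike 𝕜]

/-! Fix `Q = Q(y, ℓ)`, let `Q_0 = 2Q` and let `Q_{j+1}` be the concentric cube of twice the side of
`Q_j`. Split `f` into its restriction to `Q_0` and the rest. The exponent `E = 1/α - 1/p - 1/q` is
nonpositive, so doubling of `w` replaces `w(Q)^E` by a multiple of `w(Q_0)^E`, and the weak-type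
inequality settles the first piece.

For the second piece, the size condition and the annuli `Q_{j+1} \ Q_j` bound the operator at `x ∈
Q` by a sum of averages of `|b(x) - b(z)| |f(z)|` over `Q_{j+1}`. Inserting the means of `b` over
`Q` and `Q_{j+1}` leaves three contributions. The oscillation at `x` has `L^p(w)` norm at most a
multiple of `w(Q)^{1/p}` over `Q`. The difference of the means is `O(j + 1)`. The oscillation at `z`
is paired with `ν^{-1/p}` by Hölder; the logarithm in the bump absorbs it, and the average becomes a
multiple of `w(Q_{j+1})^{-1/p}` times the `L^p(ν)` norm of `f` on `Q_{j+1}`. What remains is a power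
`E + 1/p = 1/α - 1/q > 0` of `w(Q) / w(Q_{j+1})`, which decays geometrically and beats the linear
growth. This is `exists_weakLpNorm_indicator_le`. Minkowski's inequality in `L^q(μ)` finishes the
proof, since the supremum over `ℓ` in the norm of `f` already contains every dilated side.

The oscillation must be controlled with respect to both `dx` and `w dx`. One John–Nirenberg
induction, `measure_oscillation_gt_le`, serves both: it only needs that a subset of at most half the
volume of a cube carries at most a fixed fraction `θ < 1` of its measure (`HasHalfDecay`), which
holds for `dx` and for every `A_s` weight. -/

theorem cube_eq_preimage_closedBall (x₀ : EuclideanSpace ℝ (Fin n)) {ℓ : ℝ} (hℓ : 0 ≤ ℓ) :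
    cube x₀ ℓ = (WithLp.ofLp : EuclideanSpace ℝ (Fin n) → _) ⁻¹'
      Metric.closedBall (WithLp.ofLp x₀) (ℓ / 2) := by
  ext x
  simp [cube, dist_pi_le_iff (by positivity : 0 ≤ ℓ / 2), Real.dist_eq]

theorem isClosed_cube (x₀ : EuclideanSpace ℝ (Fin n)) (ℓ : ℝ) : IsClosed (cube x₀ ℓ) := by
  have : cube x₀ ℓ = ⋂ i, {x | |x i - x₀ i| ≤ ℓ / 2} := by ext; simp [cube]
  rw [this]
  exact isClosed_iInter fun i => isClosed_le (by fun_prop) continuous_const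

theorem measurableSet_cube (x₀ : EuclideanSpace ℝ (Fin n)) (ℓ : ℝ) : MeasurableSet (cube x₀ ℓ) :=
  (isClosed_cube x₀ ℓ).measurableSet

theorem isCompact_cube (x₀ : EuclideanSpace ℝ (Fin n)) {ℓ : ℝ} (hℓ : 0 ≤ ℓ) :
    IsCompact (cube x₀ ℓ) := by
  rw [cube_eq_preimage_closedBall x₀ hℓ]
  exact (PiLp.homeomorph 2 (fun _ : Fin n => ℝ)).isCompact_preimage.2
    (isCompact_closedBall _ _)

theorem volume_cube (x₀ : EuclideanSpace ℝ (Fin n)) {ℓ : ℝ} (hℓ : 0 ≤ ℓ) :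
    volume (cube x₀ ℓ) = ENNReal.ofReal ℓ ^ n := by
  rw [cube_eq_preimage_closedBall x₀ hℓ,
    (PiLp.volume_preserving_ofLp (Fin n)).measure_preimage
      Metric.isClosed_closedBall.measurableSet.nullMeasurableSet,
    Real.volume_pi_closedBall _ (by positivity), ← ENNReal.ofReal_pow hℓ]
  simp [mul_div_cancel₀]

theorem volume_cube_pos (x₀ : EuclideanSpace ℝ (Fin n)) {ℓ : ℝ} (hℓ : 0 < ℓ) :
    volume (cube x₀ ℓ) ≠ 0 := by
  rw [volume_cube x₀ hℓ.le]
  exact pow_ne_zero _ (by simpa using hℓ)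

theorem volume_cube_ne_top (x₀ : EuclideanSpace ℝ (Fin n)) {ℓ : ℝ} (hℓ : 0 ≤ ℓ) :
    volume (cube x₀ ℓ) ≠ ∞ := (isCompact_cube x₀ hℓ).measure_lt_top.ne

theorem volume_cube_mul (x₀ x₁ : EuclideanSpace ℝ (Fin n)) {c ℓ : ℝ} (hc : 0 ≤ c) (hℓ : 0 ≤ ℓ) :
    volume (cube x₀ (c * ℓ)) = ENNReal.ofReal c ^ n * volume (cube x₁ ℓ) := by
  rw [volume_cube x₀ (by positivity), volume_cube x₁ hℓ, ENNReal.ofReal_mul hc, mul_pow]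

theorem cube_subset_cube (x₀ : EuclideanSpace ℝ (Fin n)) {ℓ ℓ' : ℝ} (h : ℓ ≤ ℓ') :
    cube x₀ ℓ ⊆ cube x₀ ℓ' := fun x hx i => (hx i).trans (by linarith)

/-- The half-open cube differs from the closed one by a null set. -/
theorem halfOpen_ae_eq_cube (x₀ : EuclideanSpace ℝ (Fin n)) (ℓ : ℝ) :
    ({x | ∀ i, x₀ i - ℓ / 2 ≤ x i ∧ x i < x₀ i + ℓ / 2} : Set (EuclideanSpace ℝ (Fin n)))
      =ᵐ[volume] cube x₀ ℓ := by
  have h := (PiLp.volume_preserving_ofLp (Fin n)).quasiMeasurePreserving.preimage_ae_eq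
    (Measure.univ_pi_Ico_ae_eq_Icc (μ := fun _ : Fin n => (volume : Measure ℝ))
      (f := fun i => x₀ i - ℓ / 2) (g := fun i => x₀ i + ℓ / 2))
  have h₁ : ({x | ∀ i, x₀ i - ℓ / 2 ≤ x i ∧ x i < x₀ i + ℓ / 2} :
      Set (EuclideanSpace ℝ (Fin n))) = WithLp.ofLp ⁻¹'
        (univ.pi fun i => Ico (x₀ i - ℓ / 2) (x₀ i + ℓ / 2)) := by
    ext x
    simp
  have h₂ : cube x₀ ℓ = WithLp.ofLp ⁻¹'
      (Icc (fun i => x₀ i - ℓ / 2) fun i => x₀ i + ℓ / 2) := by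
    ext x
    simp only [cube, mem_ofPred_eq, mem_preimage, mem_Icc, Pi.le_def, abs_le, ← forall_and]
    refine forall_congr' fun i => ⟨fun h => ⟨by linarith [h.1], by linarith [h.2]⟩,
      fun h => ⟨by linarith [h.1], by linarith [h.2]⟩⟩
  rw [h₁, h₂]
  exact h

theorem setAverage_cube_eq {F : Type*} [NormedAddCommGroup F] [NormedSpace ℝ F]
    (g : EuclideanSpace ℝ (Fin n) → F)
    (x₀ : EuclideanSpace ℝ (Fin n)) {ℓ : ℝ} (hℓ : 0 ≤ ℓ) :
    ⨍ x in Metric.closedBall (WithLp.ofLp x₀) (ℓ / 2), g (WithLp.toLp 2 x) =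
      ⨍ x in cube x₀ ℓ, g x := by
  have hmp := PiLp.volume_preserving_ofLp (Fin n)
  rw [setAverage_eq, setAverage_eq, cube_eq_preimage_closedBall x₀ hℓ]
  congr 1
  · simp only [measureReal_def]
    rw [hmp.measure_preimage Metric.isClosed_closedBall.measurableSet.nullMeasurableSet]
  · rw [← hmp.setIntegral_preimage_emb (MeasurableEquiv.toLp 2 (Fin n → ℝ)).symm.measurableEmbedding]

/-- **Lebesgue differentiation** along cubes shrinking to a point. -/
theorem ae_tendsto_setAverage_cube {F : Type*} [NormedAddCommGroup F] [NormedSpace ℝ F]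
    [CompleteSpace F]
    {g : EuclideanSpace ℝ (Fin n) → F} (hg : LocallyIntegrable g volume) :
    ∀ᵐ x, ∀ (c : ℕ → EuclideanSpace ℝ (Fin n)) (ℓ : ℕ → ℝ), (∀ j, 0 < ℓ j) →
      Tendsto ℓ atTop (𝓝 0) → (∀ j, x ∈ cube (c j) (ℓ j)) →
      Tendsto (fun j => ⨍ z in cube (c j) (ℓ j), g z) atTop (𝓝 (g x)) := by
  have hmp := PiLp.volume_preserving_ofLp (Fin n)
  -- In the sup norm cubes are closed balls, so the differentiation theorem for doubling measures
  -- applies. Its parameter `1` says that the point lies in the ball itself, which need not be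
  -- centred there.
  have hg' : LocallyIntegrable (fun x : Fin n → ℝ => g (WithLp.toLp 2 x)) volume := by
    have := (locallyIntegrable_map_homeomorph (PiLp.homeomorph 2 (fun _ : Fin n => ℝ)).symm
      (f := g) (μ := volume)).1
    refine this ?_
    have h2 : Measure.map (PiLp.homeomorph 2 (fun _ : Fin n => ℝ)).symm volume = volume :=
      (PiLp.volume_preserving_toLp (Fin n)).map_eq
    rwa [h2]
  have h := hmp.quasiMeasurePreserving.ae
    (IsUnifLocDoublingMeasure.ae_tendsto_average (μ := volume) hg' 1)
  filter_upwards [h] with x hx c ℓ hpos hlim hmem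
  have := hx (l := atTop) (fun j => WithLp.ofLp (c j)) (fun j => ℓ j / 2) ?_ ?_
  · simpa [setAverage_cube_eq g _ (hpos _).le] using this
  · refine tendsto_nhdsWithin_iff.2 ⟨by simpa using hlim.div_const 2, ?_⟩
    exact Eventually.of_forall fun j => half_pos (hpos j)
  · refine Eventually.of_forall fun j => ?_
    have := hmem j
    rw [cube_eq_preimage_closedBall _ (hpos j).le] at this
    simpa using this

theorem integrableOn_cube {F : Type*} [NormedAddCommGroup F]
    {g : EuclideanSpace ℝ (Fin n) → F} (hg : LocallyIntegrable g volume)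
    (x₀ : EuclideanSpace ℝ (Fin n)) {ℓ : ℝ} (hℓ : 0 ≤ ℓ) : IntegrableOn g (cube x₀ ℓ) volume :=
  hg.integrableOn_isCompact (isCompact_cube x₀ hℓ)

theorem enorm_setAverage_sub_le {g : EuclideanSpace ℝ (Fin n) → 𝕜}
    (hg : LocallyIntegrable g volume) (x₀ : EuclideanSpace ℝ (Fin n)) {ℓ : ℝ} (hℓ : 0 < ℓ)
    (c : 𝕜) : ‖(⨍ x in cube x₀ ℓ, g x) - c‖ₑ ≤ ⨍⁻ x in cube x₀ ℓ, ‖g x - c‖ₑ ∂volume := by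
  have hint := integrableOn_cube hg x₀ hℓ.le
  have : IsFiniteMeasure (volume.restrict (cube x₀ ℓ)) :=
    ⟨by simpa using (volume_cube_ne_top x₀ hℓ.le).lt_top⟩
  have : NeZero (volume.restrict (cube x₀ ℓ)) :=
    ⟨by simpa [Measure.restrict_eq_zero] using volume_cube_pos x₀ hℓ⟩
  have h : (⨍ x in cube x₀ ℓ, g x) - c = ⨍ x in cube x₀ ℓ, (g x - c) := by
    have hc : ⨍ _ in cube x₀ ℓ, c = c := average_const _ c
    nth_rewrite 1 [← hc]
    simp only [average]
    rw [integral_sub (hint.integrable.smul_measure (by simp [volume_cube_pos x₀ hℓ]))]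
    exact (integrable_const c).smul_measure (by simp [volume_cube_pos x₀ hℓ])
  rw [h, average, laverage]
  exact enorm_integral_le_lintegral_enorm _

/-- The factor is the ratio of the volumes. Inclusion up to a null set suffices, so that the nesting
of half-open dyadic cubes passes to closed cubes. -/
theorem laverage_cube_le_of_subset (h : EuclideanSpace ℝ (Fin n) → ℝ≥0∞)
    {x₀ x₁ : EuclideanSpace ℝ (Fin n)} {c ℓ : ℝ} (hc : 0 < c) (hℓ : 0 < ℓ)
    (hsub : cube x₀ ℓ ≤ᵐ[volume] cube x₁ (c * ℓ)) :
    ⨍⁻ x in cube x₀ ℓ, h x ∂volume ≤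
      ENNReal.ofReal c ^ n * ⨍⁻ x in cube x₁ (c * ℓ), h x ∂volume := by
  have hc0 : ENNReal.ofReal c ^ n ≠ 0 := pow_ne_zero _ (by simpa using hc)
  have hct : ENNReal.ofReal c ^ n ≠ ∞ := ENNReal.pow_ne_top ENNReal.ofReal_ne_top
  rw [setLAverage_eq, setLAverage_eq, volume_cube_mul x₁ x₀ hc.le hℓ.le, ← mul_div_assoc,
    ENNReal.mul_div_mul_left _ _ hc0 hct]
  exact ENNReal.div_le_div_right (lintegral_mono_set' hsub) _

end CubeGeometry

/-! ### Dyadic subcubes of a given cube. -/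

section Dyadic

open Filter Topology

variable {n : ℕ}

/-- The index of the half-open dyadic subcube of generation `k` of `cube x₀ ℓ` (or of its
translates) that contains `x`. -/
noncomputable def dyadicIndex (x₀ : EuclideanSpace ℝ (Fin n)) (ℓ : ℝ) (k : ℕ) (x : EuclideanSpace ℝ (Fin n)) :
    Fin n → ℤ := fun i => ⌊2 ^ k * ((x i - x₀ i) / ℓ + 1 / 2)⌋

/-- The centre of the dyadic cube of generation `k` and index `m`. -/
noncomputable def dyadicCenter (x₀ : EuclideanSpace ℝ (Fin n)) (ℓ : ℝ) (k : ℕ) (m : Fin n → ℤ) :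
    EuclideanSpace ℝ (Fin n) :=
  WithLp.toLp 2 fun i => x₀ i + (((m i : ℝ) + 1 / 2) / 2 ^ k - 1 / 2) * ℓ

theorem measurable_dyadicIndex (x₀ : EuclideanSpace ℝ (Fin n)) (ℓ : ℝ) (k : ℕ) :
    Measurable (dyadicIndex x₀ ℓ k) := by
  refine measurable_pi_lambda _ fun i => Int.measurable_floor.comp ?_
  fun_prop

/-- Passing to the dyadic parent halves the index, because `⌊t⌋ = ⌊2t⌋ / 2` in integer division.
Nestedness of the generations rests on this. -/
theorem dyadicIndex_eq_div_two (x₀ : EuclideanSpace ℝ (Fin n)) (ℓ : ℝ) (k : ℕ)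
    (x : EuclideanSpace ℝ (Fin n)) (i : Fin n) :
    dyadicIndex x₀ ℓ k x i = dyadicIndex x₀ ℓ (k + 1) x i / 2 := by
  have := Int.floor_div_natCast (2 ^ (k + 1) * ((x i - x₀ i) / ℓ + 1 / 2)) 2
  simp only [dyadicIndex]
  push_cast at this
  rw [← this]
  congr 1
  ring

theorem dyadicIndex_eq_of_le {x₀ : EuclideanSpace ℝ (Fin n)} {ℓ : ℝ} {j k : ℕ} (hjk : j ≤ k)
    {x y : EuclideanSpace ℝ (Fin n)} (h : dyadicIndex x₀ ℓ k x = dyadicIndex x₀ ℓ k y) :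
    dyadicIndex x₀ ℓ j x = dyadicIndex x₀ ℓ j y := by
  induction k, hjk using Nat.le_induction with
  | base => exact h
  | succ k _ ih =>
    refine ih (funext fun i => ?_)
    rw [dyadicIndex_eq_div_two x₀ ℓ k x, dyadicIndex_eq_div_two x₀ ℓ k y, h]

theorem dyadicIndex_preimage_eq (x₀ : EuclideanSpace ℝ (Fin n)) {ℓ : ℝ} (hℓ : 0 < ℓ) (k : ℕ)
    (m : Fin n → ℤ) :
    dyadicIndex x₀ ℓ k ⁻¹' {m} = {x | ∀ i, dyadicCenter x₀ ℓ k m i - ℓ / 2 ^ k / 2 ≤ x i ∧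
      x i < dyadicCenter x₀ ℓ k m i + ℓ / 2 ^ k / 2} := by
  ext x
  have hk : (0 : ℝ) < 2 ^ k := by positivity
  simp only [mem_preimage, mem_singleton_iff, funext_iff, dyadicIndex, mem_ofPred_eq,
    Int.floor_eq_iff, dyadicCenter]
  refine forall_congr' fun i => and_congr ?_ ?_
  · have h : x i - (x₀ i + (((m i : ℝ) + 1 / 2) / 2 ^ k - 1 / 2) * ℓ - ℓ / 2 ^ k / 2) =
        (ℓ / 2 ^ k) * (2 ^ k * ((x i - x₀ i) / ℓ + 1 / 2) - m i) := by
      field_simp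
      ring
    rw [← sub_nonneg, ← sub_nonneg (b := _ - ℓ / 2 ^ k / 2), h]
    exact (mul_nonneg_iff_of_pos_left (by positivity)).symm
  · have h : (x₀ i + (((m i : ℝ) + 1 / 2) / 2 ^ k - 1 / 2) * ℓ + ℓ / 2 ^ k / 2) - x i =
        (ℓ / 2 ^ k) * (m i + 1 - 2 ^ k * ((x i - x₀ i) / ℓ + 1 / 2)) := by
      field_simp
      ring
    rw [← sub_pos, ← sub_pos (b := x i), h]
    exact (mul_pos_iff_of_pos_left (by positivity)).symm

theorem dyadicIndex_preimage_ae_eq (x₀ : EuclideanSpace ℝ (Fin n)) {ℓ : ℝ} (hℓ : 0 < ℓ) (k : ℕ)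
    (m : Fin n → ℤ) :
    dyadicIndex x₀ ℓ k ⁻¹' {m} =ᵐ[volume] cube (dyadicCenter x₀ ℓ k m) (ℓ / 2 ^ k) := by
  rw [dyadicIndex_preimage_eq x₀ hℓ]
  exact halfOpen_ae_eq_cube _ _

theorem mem_cube_dyadicIndex (x₀ : EuclideanSpace ℝ (Fin n)) {ℓ : ℝ} (hℓ : 0 < ℓ) (k : ℕ)
    (x : EuclideanSpace ℝ (Fin n)) :
    x ∈ cube (dyadicCenter x₀ ℓ k (dyadicIndex x₀ ℓ k x)) (ℓ / 2 ^ k) := by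
  have h : x ∈ dyadicIndex x₀ ℓ k ⁻¹' {dyadicIndex x₀ ℓ k x} := rfl
  rw [dyadicIndex_preimage_eq x₀ hℓ] at h
  exact fun i => abs_le.2 ⟨by linarith [(h i).1], by linarith [(h i).2]⟩

theorem dyadicCenter_zero (x₀ : EuclideanSpace ℝ (Fin n)) (ℓ : ℝ) :
    dyadicCenter x₀ ℓ 0 0 = x₀ := by
  ext i
  simp [dyadicCenter]

theorem dyadicIndex_preimage_zero_ae_eq (x₀ : EuclideanSpace ℝ (Fin n)) {ℓ : ℝ} (hℓ : 0 < ℓ) :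
    dyadicIndex x₀ ℓ 0 ⁻¹' {0} =ᵐ[volume] cube x₀ ℓ := by
  simpa [dyadicCenter_zero] using dyadicIndex_preimage_ae_eq x₀ hℓ 0 0

end Dyadic

/-! ### Calderón–Zygmund stopping cubes. -/

section Stopping

open Filter Topology

variable {n : ℕ}

/-- **Calderón–Zygmund decomposition** of a cube: the closed cubes `cube (c i) (s i)` are the
maximal dyadic subcubes on which the average of `h` exceeds `K`. -/
theorem exists_stopping_cubes {h : EuclideanSpace ℝ (Fin n) → ℝ} (hh : LocallyIntegrable h volume)
    (hh0 : 0 ≤ h) (x₀ : EuclideanSpace ℝ (Fin n)) {ℓ : ℝ} (hℓ : 0 < ℓ) {K : ℝ≥0∞} (hK : K ≠ ∞)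
    (hK0 : K ≠ 0)
    (havg : 2 * ⨍⁻ x in cube x₀ ℓ, ENNReal.ofReal (h x) ∂volume ≤ K) :
    ∃ (S : Set (ℕ × (Fin n → ℤ))) (A : ℕ × (Fin n → ℤ) → Set (EuclideanSpace ℝ (Fin n)))
      (c : ℕ × (Fin n → ℤ) → EuclideanSpace ℝ (Fin n)) (s : ℕ × (Fin n → ℤ) → ℝ),
      (∀ i, 0 < s i) ∧ (∀ i, MeasurableSet (A i)) ∧ (∀ i, A i =ᵐ[volume] cube (c i) (s i)) ∧
      S.PairwiseDisjoint A ∧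
      (∀ i ∈ S, ⨍⁻ x in cube (c i) (s i), ENNReal.ofReal (h x) ∂volume ≤ 2 ^ n * K) ∧
      2 * volume (cube x₀ ℓ ∩ ⋃ i ∈ S, A i) ≤ volume (cube x₀ ℓ) ∧
      (∀ i ∈ S, A i ≤ᵐ[volume] cube x₀ ℓ) ∧
      ∀ᵐ x, x ∈ cube x₀ ℓ → x ∉ (⋃ i ∈ S, A i) → ENNReal.ofReal (h x) ≤ K := by
  set c : ℕ × (Fin n → ℤ) → EuclideanSpace ℝ (Fin n) := fun i => dyadicCenter x₀ ℓ i.1 i.2 with hc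
  set s : ℕ × (Fin n → ℤ) → ℝ := fun i => ℓ / 2 ^ i.1 with hs
  set A : ℕ × (Fin n → ℤ) → Set (EuclideanSpace ℝ (Fin n)) :=
    fun i => dyadicIndex x₀ ℓ i.1 ⁻¹' {i.2} with hA
  set avg : ℕ × (Fin n → ℤ) → ℝ≥0∞ :=
    fun i => ⨍⁻ x in cube (c i) (s i), ENNReal.ofReal (h x) ∂volume with hav
  have hspos : ∀ i, 0 < s i := fun i => by positivity
  have hAae : ∀ i, A i =ᵐ[volume] cube (c i) (s i) := fun i =>
    dyadicIndex_preimage_ae_eq x₀ hℓ i.1 i.2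
  have hAmeas : ∀ i, MeasurableSet (A i) := fun i =>
    measurable_dyadicIndex x₀ ℓ i.1 (measurableSet_singleton _)
  -- The point `x` is a witness inside the cube; the last clause says that no proper ancestor
  -- exceeds `K`, which is maximality.
  set S : Set (ℕ × (Fin n → ℤ)) := {i | K < avg i ∧ ∃ x, dyadicIndex x₀ ℓ 0 x = 0 ∧
    dyadicIndex x₀ ℓ i.1 x = i.2 ∧ ∀ j < i.1, avg (j, dyadicIndex x₀ ℓ j x) ≤ K} with hS
  have hcube0 : c (0, 0) = x₀ := dyadicCenter_zero x₀ ℓ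
  have hs0 : s (0, 0) = ℓ := by simp [hs]
  have havg0 : avg (0, 0) ≤ K := by
    simp only [hav, hcube0, hs0]
    refine le_trans ?_ havg
    exact le_mul_of_one_le_left (by positivity) one_le_two
  have hAsub : ∀ i ∈ S, A i ⊆ dyadicIndex x₀ ℓ 0 ⁻¹' {0} := by
    rintro ⟨k, m⟩ ⟨-, x, hx0, hxm, -⟩ z hz
    have hz' : dyadicIndex x₀ ℓ k z = m := hz
    exact (dyadicIndex_eq_of_le (Nat.zero_le k) (hz'.trans hxm.symm)).trans hx0
  have hdisj : S.PairwiseDisjoint A := by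
    have key : ∀ i ∈ S, ∀ j ∈ S, i.1 < j.1 → Disjoint (A i) (A j) := by
      rintro ⟨k, m⟩ ⟨hi, -⟩ ⟨k', m'⟩ ⟨-, x, -, hx, hle⟩ hlt
      refine Set.disjoint_left.2 fun z hz hz' => ?_
      have h1 : dyadicIndex x₀ ℓ k z = m := hz
      have h2 : dyadicIndex x₀ ℓ k' z = m' := hz'
      have h3 := dyadicIndex_eq_of_le hlt.le (h2.trans hx.symm)
      have h4 := hle k hlt
      rw [← h3, h1] at h4
      exact absurd hi (not_lt.2 h4)
    intro i hi j hj hij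
    rcases lt_trichotomy i.1 j.1 with h | h | h
    · exact key i hi j hj h
    · refine Set.disjoint_left.2 fun z hz hz' => hij ?_
      have h1 : dyadicIndex x₀ ℓ i.1 z = i.2 := hz
      have h2 : dyadicIndex x₀ ℓ j.1 z = j.2 := hz'
      exact Prod.ext h (by rw [← h1, ← h2, h])
    · exact (key j hj i hi h).symm
  have hAQ : ∀ i ∈ S, A i ≤ᵐ[volume] cube x₀ ℓ := fun i hi =>
    (LE.le.eventuallyLE (hAsub i hi)).trans (dyadicIndex_preimage_zero_ae_eq x₀ hℓ).le
  refine ⟨S, A, c, s, hspos, hAmeas, hAae, hdisj, ?_, ?_, hAQ, ?_⟩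
  · rintro ⟨k, m⟩ ⟨hgt, x, hx0, hxm, hle⟩
    rcases k with _ | k
    · have hm : m = 0 := hxm.symm.trans hx0
      subst hm
      exact absurd hgt (not_lt.2 havg0)
    -- The parent was not selected, so its average is at most `K`, and it has `2 ^ n` times the
    -- volume.
    · have hp := hle k (Nat.lt_succ_self k)
      have hss : s (k, dyadicIndex x₀ ℓ k x) = 2 * s (k + 1, m) := by
        simp only [hs, pow_succ]
        field_simp
      have hsub : cube (c (k + 1, m)) (s (k + 1, m)) ≤ᵐ[volume]
          cube (c (k, dyadicIndex x₀ ℓ k x)) (2 * s (k + 1, m)) := by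
        rw [← hss]
        refine (hAae _).symm.le.trans (EventuallyLE.trans (LE.le.eventuallyLE ?_)
          (hAae _).le)
        intro z hz
        have hz' : dyadicIndex x₀ ℓ (k + 1) z = m := hz
        exact dyadicIndex_eq_of_le (Nat.le_succ k) (hz'.trans hxm.symm)
      refine (laverage_cube_le_of_subset _ two_pos (hspos _) hsub).trans ?_
      rw [← hss]
      simpa using mul_le_mul_right hp (2 ^ n)
  · have hQ0 := volume_cube_pos x₀ hℓ
    have hQt := volume_cube_ne_top x₀ hℓ.le
    -- Each selected cube satisfies `K |A i| ≤ ∫_{A i} h`; disjointness allows summation. With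
    -- `havg` this gives the bound by half the volume.
    have hU : volume (⋃ i ∈ S, A i) * K ≤
        ∫⁻ x in cube x₀ ℓ, ENNReal.ofReal (h x) := by
      rw [measure_biUnion S.to_countable hdisj fun i _ => hAmeas i, ← ENNReal.tsum_mul_right]
      have h1 : ∀ i : S, volume (A i) * K ≤ ∫⁻ x in A i, ENNReal.ofReal (h x) := by
        intro i
        have hi : K < avg i := i.2.1
        rw [setLIntegral_congr (hAae i), measure_congr (hAae i)]
        have := hi.le
        simp only [hav] at this
        rw [setLAverage_eq, ENNReal.le_div_iff_mul_le (Or.inl (volume_cube_pos _ (hspos _)))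
          (Or.inl (volume_cube_ne_top _ (hspos _).le)), mul_comm] at this
        exact this
      refine (ENNReal.tsum_le_tsum h1).trans ?_
      have h2 := (lintegral_biUnion (μ := volume) S.to_countable (fun i _ => hAmeas i) hdisj
        (fun x => ENNReal.ofReal (h x)))
      rw [← h2]
      refine lintegral_mono_set' ?_
      refine EventuallyLE.trans (LE.le.eventuallyLE ?_)
        (dyadicIndex_preimage_zero_ae_eq x₀ hℓ).le
      exact iUnion₂_subset hAsub
    have h3 : ∫⁻ x in cube x₀ ℓ, ENNReal.ofReal (h x) =
        volume (cube x₀ ℓ) * ⨍⁻ x in cube x₀ ℓ, ENNReal.ofReal (h x) ∂volume := by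
      rw [setLAverage_eq, ENNReal.mul_div_cancel hQ0 hQt]
    refine (ENNReal.mul_le_mul_iff_left hK0 hK).1 ?_
    calc 2 * volume (cube x₀ ℓ ∩ ⋃ i ∈ S, A i) * K
        ≤ 2 * (volume (⋃ i ∈ S, A i) * K) := by
          rw [mul_assoc]; gcongr; exact inter_subset_right
      _ ≤ 2 * (volume (cube x₀ ℓ) * ⨍⁻ x in cube x₀ ℓ, ENNReal.ofReal (h x) ∂volume) := by
          rw [← h3]; gcongr
      _ = volume (cube x₀ ℓ) * (2 * ⨍⁻ x in cube x₀ ℓ, ENNReal.ofReal (h x) ∂volume) := by ring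
      _ ≤ volume (cube x₀ ℓ) * K := by gcongr
  · filter_upwards [ae_tendsto_setAverage_cube hh, (dyadicIndex_preimage_zero_ae_eq x₀ hℓ).mem_iff]
      with x hx hmem hxQ hxU
    have hx0 : dyadicIndex x₀ ℓ 0 x = 0 := hmem.2 hxQ
    -- A first dyadic cube around `x` with average above `K` would belong to `S`, so all averages
    -- stay below `K` and Lebesgue differentiation bounds `h x`.
    have hall : ∀ k, avg (k, dyadicIndex x₀ ℓ k x) ≤ K := by
      intro k
      induction k using Nat.strong_induction_on with
      | _ k ih =>
        by_contra hcon
        refine hxU (mem_iUnion₂.2 ⟨(k, dyadicIndex x₀ ℓ k x), ⟨not_le.1 hcon, x, hx0, rfl, ih⟩, rfl⟩)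
    have hlim := hx (fun k => c (k, dyadicIndex x₀ ℓ k x)) (fun k => ℓ / 2 ^ k)
      (fun k => by positivity) ?_ (fun k => mem_cube_dyadicIndex x₀ hℓ k x)
    · refine le_of_tendsto' (ENNReal.tendsto_ofReal hlim) fun k => ?_
      refine le_trans (le_of_eq ?_) (hall k)
      have hint := integrableOn_cube hh (c (k, dyadicIndex x₀ ℓ k x))
        (hspos (k, dyadicIndex x₀ ℓ k x)).le
      exact (ofReal_setAverage hint (ae_of_all _ hh0)).trans (setLAverage_eq _ _ _).symm
    · have := tendsto_const_nhds (x := ℓ) (f := atTop (α := ℕ))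
      simpa [div_eq_mul_inv] using
        (tendsto_pow_atTop_nhds_zero_of_lt_one (r := (2 : ℝ)⁻¹) (by norm_num)
          (by norm_num)).const_mul ℓ

end Stopping

/-! ### The John–Nirenberg inequality for general measures. -/

section JohnNirenberg

open Filter Topology

variable {n : ℕ} {𝕜 : Type*} [RCLike 𝕜]

/-- Subsets of a cube of at most half its volume carry at most the fraction `θ` of its
`m`-measure. -/
def HasHalfDecay (m : Measure (EuclideanSpace ℝ (Fin n))) (θ : ℝ≥0) : Prop :=
  ∀ (x₀ : EuclideanSpace ℝ (Fin n)) (ℓ : ℝ), 0 < ℓ → ∀ E ⊆ cube x₀ ℓ, MeasurableSet E →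
    2 * volume E ≤ volume (cube x₀ ℓ) → m E ≤ θ * m (cube x₀ ℓ)

theorem hasHalfDecay_volume : HasHalfDecay (volume : Measure (EuclideanSpace ℝ (Fin n))) 2⁻¹ := by
  intro x₀ ℓ _ E _ _ hE
  rw [ENNReal.coe_inv two_ne_zero, ← ENNReal.mul_le_iff_le_inv (by simp) (by simp)]
  exact hE

/-- The mean oscillation over every cube is at most `B`. -/
def MeanOscillationLE (b : EuclideanSpace ℝ (Fin n) → 𝕜) (B : ℝ≥0) : Prop :=
  ∀ (x₀ : EuclideanSpace ℝ (Fin n)) (ℓ : ℝ), 0 < ℓ →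
    ⨍⁻ x in cube x₀ ℓ, ‖b x - ⨍ y in cube x₀ ℓ, b y‖ₑ ∂volume ≤ B

/-- The **John–Nirenberg inequality** with respect to a measure with half decay. -/
theorem measure_oscillation_gt_le {m : Measure (EuclideanSpace ℝ (Fin n))} (hm : m ≪ volume)
    {θ : ℝ≥0} (hθ : HasHalfDecay m θ) {b : EuclideanSpace ℝ (Fin n) → 𝕜}
    (hb : LocallyIntegrable b volume) {B : ℝ≥0} (hB : 0 < B) (hosc : MeanOscillationLE b B)
    (k : ℕ) (x₀ : EuclideanSpace ℝ (Fin n)) {ℓ : ℝ} (hℓ : 0 < ℓ) :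
    m {x ∈ cube x₀ ℓ | (k * (2 ^ n * (2 * B)) : ℝ≥0∞) < ‖b x - ⨍ y in cube x₀ ℓ, b y‖ₑ} ≤
      θ ^ k * m (cube x₀ ℓ) := by
  induction k generalizing x₀ ℓ with
  | zero => simpa using measure_mono (fun x hx => hx.1)
  | succ k ih =>
    set bQ := ⨍ y in cube x₀ ℓ, b y with hbQ
    have hK0 : (2 * B : ℝ≥0∞) ≠ 0 := by simpa using hB.ne'
    have hKt : (2 * B : ℝ≥0∞) ≠ ∞ := ENNReal.mul_ne_top (by simp) (by simp)
    have hloc : LocallyIntegrable (fun x => ‖b x - bQ‖) volume :=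
      fun x => (hb.sub (locallyIntegrable_const bQ) x).norm
    -- Height `2B` is twice the bound on the mean oscillation, so the stopping cubes fill at most
    -- half of the cube.
    obtain ⟨S, A, c, s, hs, hAm, hAae, hdisj, havg, hvol, hAQ, hoff⟩ :=
      exists_stopping_cubes hloc (fun x => norm_nonneg _) x₀ hℓ hKt hK0
        (by simpa using mul_le_mul_right (hosc x₀ ℓ hℓ) 2)
    simp only [ofReal_norm] at havg hoff
    have hAem : ∀ i, m (A i) = m (cube (c i) (s i)) := fun i =>
      measure_congr (hm.ae_eq (hAae i))
    set L : ℝ≥0∞ := 2 ^ n * (2 * B) with hL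
    have hLt : L ≠ ∞ := ENNReal.mul_ne_top (by simp) hKt
    have hKL : (2 * B : ℝ≥0∞) ≤ L := le_mul_of_one_le_left (by positivity)
      (one_le_pow_of_one_le' one_le_two n)
    -- Off the stopping cubes the oscillation is at most `2B ≤ L`. On one of them the mean differs
    -- from `bQ` by at most `L`, so an oscillation above `(k + 1) L` about `bQ` exceeds `k L` about
    -- the local mean, where the induction hypothesis applies.
    have hsub : {x ∈ cube x₀ ℓ | (((k + 1 : ℕ) : ℝ≥0∞) * L) < ‖b x - bQ‖ₑ} ≤ᵐ[volume]
        ⋃ i ∈ S, A i ∩ {x | (k * L : ℝ≥0∞) < ‖b x - ⨍ y in cube (c i) (s i), b y‖ₑ} := by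
      filter_upwards [hoff] with x hx hxT
      obtain ⟨hxQ, hxT⟩ := hxT
      have hxU : x ∈ ⋃ i ∈ S, A i := by
        by_contra hcon
        refine absurd hxT (not_lt.2 ((hx hxQ hcon).trans (hKL.trans ?_)))
        refine le_mul_of_one_le_left (by positivity) ?_
        simp
      obtain ⟨i, hi, hxA⟩ := mem_iUnion₂.1 hxU
      refine mem_iUnion₂.2 ⟨i, hi, hxA, ?_⟩
      have h1 : ‖(⨍ y in cube (c i) (s i), b y) - bQ‖ₑ ≤ L :=
        (enorm_setAverage_sub_le hb (c i) (hs i) bQ).trans (havg i hi)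
      have h2 : ‖b x - bQ‖ₑ ≤ ‖b x - ⨍ y in cube (c i) (s i), b y‖ₑ + L := by
        refine le_trans ?_ (add_le_add_right h1 _)
        refine le_trans (le_of_eq ?_) (enorm_add_le _ _)
        congr 1
        ring
      have h3 : (k * L : ℝ≥0∞) + L < ‖b x - ⨍ y in cube (c i) (s i), b y‖ₑ + L := by
        refine lt_of_lt_of_le ?_ h2
        convert hxT using 1
        push_cast
        ring
      exact lt_of_add_lt_add_right h3
    calc m {x ∈ cube x₀ ℓ | (((k + 1 : ℕ) : ℝ≥0∞) * L) < ‖b x - bQ‖ₑ}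
        ≤ m (⋃ i ∈ S, A i ∩ {x | (k * L : ℝ≥0∞) < ‖b x - ⨍ y in cube (c i) (s i), b y‖ₑ}) :=
          measure_mono_ae (hm.ae_le hsub)
      _ ≤ ∑' i : S, m (A i ∩ {x | (k * L : ℝ≥0∞) < ‖b x - ⨍ y in cube (c i) (s i), b y‖ₑ}) :=
          measure_biUnion_le m S.to_countable _
      _ ≤ ∑' i : S, θ ^ k * m (A i) := by
          refine ENNReal.tsum_le_tsum fun i => ?_
          rw [hAem]
          refine le_trans (measure_mono_ae ?_) (ih (c i) (hs i))
          have h : A i ≤ᵐ[m] cube (c i) (s i) := hm.ae_le (hAae i).le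
          exact h.inter (EventuallyLE.refl _ _)
      _ = θ ^ k * m (⋃ i ∈ S, A i) := by
          rw [ENNReal.tsum_mul_left, measure_biUnion S.to_countable hdisj fun i _ => hAm i]
      _ ≤ θ ^ k * m (cube x₀ ℓ ∩ ⋃ i ∈ S, A i) := by
          gcongr 1
          refine measure_mono_ae (hm.ae_le ?_)
          have : (⋃ i ∈ S, A i) ≤ᵐ[volume] cube x₀ ℓ := by
            have h := (ae_ball_iff S.to_countable).2 hAQ
            filter_upwards [h] with x hx hxU
            obtain ⟨i, hi, hxA⟩ := mem_iUnion₂.1 hxU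
            exact hx i hi hxA
          filter_upwards [this] with x hx hxU using ⟨hx hxU, hxU⟩
      _ ≤ θ ^ k * (θ * m (cube x₀ ℓ)) := by
          gcongr 1
          exact hθ x₀ ℓ hℓ _ inter_subset_left ((measurableSet_cube x₀ ℓ).inter
            (MeasurableSet.biUnion S.to_countable fun i _ => hAm i)) hvol
      _ = θ ^ (k + 1) * m (cube x₀ ℓ) := by ring

/-- Exponential integrability of the oscillation, with constants that do not depend on the cube. -/
theorem exists_exp_oscillation_le {m : Measure (EuclideanSpace ℝ (Fin n))} (hm : m ≪ volume)
    {θ : ℝ≥0} (hθ1 : θ < 1) (hθ : HasHalfDecay m θ) {b : EuclideanSpace ℝ (Fin n) → 𝕜}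
    (hb : LocallyIntegrable b volume) {B : ℝ≥0} (hB : 0 < B) (hosc : MeanOscillationLE b B) :
    ∃ κ : ℝ, 0 < κ ∧ ∃ C : ℝ≥0, ∀ (x₀ : EuclideanSpace ℝ (Fin n)) (ℓ : ℝ), 0 < ℓ →
      ∫⁻ x in cube x₀ ℓ, ENNReal.ofReal (Real.exp (κ * ‖b x - ⨍ y in cube x₀ ℓ, b y‖)) ∂m ≤
        C * m (cube x₀ ℓ) := by
  set L : ℝ := 2 ^ n * (2 * B) with hL
  have hLpos : 0 < L := by positivity
  -- By continuity at `κ = 0`, where the product is `θ < 1`. The series over the levels `k L` is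
  -- then geometric with ratio `exp (κ L) θ`.
  obtain ⟨κ, hκ, hκθ⟩ : ∃ κ : ℝ, 0 < κ ∧ Real.exp (κ * L) * θ < 1 := by
    have hc : ContinuousAt (fun κ : ℝ => Real.exp (κ * L) * θ) 0 := by fun_prop
    have h0 : (fun κ : ℝ => Real.exp (κ * L) * θ) 0 < 1 := by simpa using hθ1
    have h := (hc.eventually_lt continuousAt_const h0).filter_mono
      (nhdsWithin_le_nhds (s := Ioi 0))
    obtain ⟨κ, h1, h2⟩ := (h.and self_mem_nhdsWithin).exists
    exact ⟨κ, h2, h1⟩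
  set ρ : ℝ≥0 := (Real.exp (κ * L)).toNNReal with hρ
  have hρθ : ρ * θ < 1 := by
    rw [← NNReal.coe_lt_coe]
    simpa [hρ, (Real.exp_pos _).le] using hκθ
  refine ⟨κ, hκ, 1 + ρ * (1 - ρ * θ)⁻¹, fun x₀ ℓ hℓ => ?_⟩
  set G : EuclideanSpace ℝ (Fin n) → ℝ := fun x => ‖b x - ⨍ y in cube x₀ ℓ, b y‖ with hG
  set T : ℕ → Set (EuclideanSpace ℝ (Fin n)) :=
    fun k => {x ∈ cube x₀ ℓ | (k * (2 ^ n * (2 * B)) : ℝ≥0∞) < ‖b x - ⨍ y in cube x₀ ℓ, b y‖ₑ}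
    with hT
  have hTiff : ∀ k x, x ∈ T k ↔ x ∈ cube x₀ ℓ ∧ k * L < G x := by
    intro k x
    have h1 : (k * (2 ^ n * (2 * B)) : ℝ≥0∞) = ENNReal.ofReal (k * L) := by
      rw [hL, ENNReal.ofReal_mul (by positivity), ENNReal.ofReal_mul (by positivity),
        ENNReal.ofReal_mul (by positivity), ENNReal.ofReal_pow (by positivity)]
      simp
    simp only [hT, mem_ofPred_eq, h1, ← ofReal_norm, hG]
    rw [ENNReal.ofReal_lt_ofReal_iff_of_nonneg (by positivity)]
  have hTm : ∀ k, NullMeasurableSet (T k) m := by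
    intro k
    have hae : AEMeasurable (fun x => ‖b x - ⨍ y in cube x₀ ℓ, b y‖ₑ) m :=
      ((hb.aestronglyMeasurable.sub aestronglyMeasurable_const).mono_ac hm).enorm
    exact (measurableSet_cube x₀ ℓ).nullMeasurableSet.inter
      (nullMeasurableSet_lt aemeasurable_const hae)
  -- If `k L < G x ≤ (k + 1) L`, the term of index `k` alone dominates. The summand `1` covers `G x
  -- = 0`, which lies in no `T k`.
  have hpt : ∀ x ∈ cube x₀ ℓ, ENNReal.ofReal (Real.exp (κ * G x)) ≤
      1 + ∑' k : ℕ, (T k).indicator (fun _ => (ρ : ℝ≥0∞) ^ (k + 1)) x := by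
    intro x hx
    rcases (norm_nonneg (b x - ⨍ y in cube x₀ ℓ, b y)).eq_or_lt with h0 | h0
    · have : G x = 0 := h0.symm
      simp [this]
    · have hGpos : 0 < G x := h0
      obtain ⟨k, hk⟩ : ∃ k : ℕ, ⌈G x / L⌉₊ = k + 1 :=
        Nat.exists_eq_succ_of_ne_zero (Nat.ceil_pos.2 (by positivity)).ne'
      have hk1 : k * L < G x := by
        have : (k : ℝ) < G x / L := Nat.lt_ceil.1 (by omega)
        exact (lt_div_iff₀ hLpos).1 this
      have hk2 : G x ≤ (k + 1) * L := by
        have : G x / L ≤ (k + 1 : ℕ) := Nat.ceil_le.1 hk.le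
        push_cast at this
        exact (div_le_iff₀ hLpos).1 this
      refine le_trans ?_ le_add_self
      refine le_trans ?_ (ENNReal.le_tsum k)
      rw [indicator_of_mem ((hTiff k x).2 ⟨hx, hk1⟩)]
      have : (ρ : ℝ≥0∞) ^ (k + 1) = ENNReal.ofReal (Real.exp (κ * ((k + 1) * L))) := by
        have h2 : κ * (((k : ℝ) + 1) * L) = ((k + 1 : ℕ) : ℝ) * (κ * L) := by push_cast; ring
        rw [h2, Real.exp_nat_mul, ENNReal.ofReal_pow (Real.exp_pos _).le]
        rfl
      rw [this]
      gcongr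
  calc ∫⁻ x in cube x₀ ℓ, ENNReal.ofReal (Real.exp (κ * G x)) ∂m
      ≤ ∫⁻ x in cube x₀ ℓ, (1 + ∑' k : ℕ, (T k).indicator (fun _ => (ρ : ℝ≥0∞) ^ (k + 1)) x) ∂m :=
        setLIntegral_mono' (measurableSet_cube x₀ ℓ) hpt
    _ ≤ m (cube x₀ ℓ) + ∑' k : ℕ, (ρ : ℝ≥0∞) ^ (k + 1) * m (T k) := by
        rw [lintegral_add_left measurable_const, setLIntegral_one, lintegral_tsum]
        · gcongr with k
          rw [lintegral_indicator_const₀ ((hTm k).mono_ac Measure.restrict_le_self.absolutelyContinuous)]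
          gcongr
          exact Measure.restrict_le_self
        · exact fun k => aemeasurable_const.indicator₀
            ((hTm k).mono_ac Measure.restrict_le_self.absolutelyContinuous)
    _ ≤ m (cube x₀ ℓ) + ∑' k : ℕ, (ρ : ℝ≥0∞) ^ (k + 1) * (θ ^ k * m (cube x₀ ℓ)) := by
        gcongr with k
        exact measure_oscillation_gt_le hm hθ hb hB hosc k x₀ hℓ
    _ = ((1 + ρ * (1 - ρ * θ)⁻¹ : ℝ≥0) : ℝ≥0∞) * m (cube x₀ ℓ) := by
        have h1 : ∀ k : ℕ, (ρ : ℝ≥0∞) ^ (k + 1) * (θ ^ k * m (cube x₀ ℓ)) =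
            (ρ * m (cube x₀ ℓ)) * ((ρ * θ : ℝ≥0) : ℝ≥0∞) ^ k := by
          intro k
          push_cast
          ring
        simp only [h1]
        rw [ENNReal.tsum_mul_left, ENNReal.tsum_geometric]
        have h2 : (1 - ((ρ * θ : ℝ≥0) : ℝ≥0∞))⁻¹ = (((1 - ρ * θ)⁻¹ : ℝ≥0) : ℝ≥0∞) := by
          rw [ENNReal.coe_inv (tsub_pos_of_lt hρθ).ne']
          push_cast
          rfl
        rw [h2]
        push_cast
        ring

end JohnNirenberg

/-! ### Muckenhoupt weights: doubling, half decay, oscillation. -/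

section Weights

open Filter Topology

variable {n : ℕ} {𝕜 : Type*} [RCLike 𝕜]

theorem IsWeight.aemeasurable {w : EuclideanSpace ℝ (Fin n) → ℝ≥0} (hw : IsWeight w) :
    AEMeasurable w volume := by
  simpa using (LocallyIntegrable.aestronglyMeasurable hw).aemeasurable.real_toNNReal

theorem IsWeight.aemeasurable_enn {w : EuclideanSpace ℝ (Fin n) → ℝ≥0} (hw : IsWeight w) :
    AEMeasurable (fun x => (w x : ℝ≥0∞)) volume := hw.aemeasurable.coe_nnreal_ennreal

theorem weightMeasure_absolutelyContinuous (w : EuclideanSpace ℝ (Fin n) → ℝ≥0) :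
    weightMeasure w ≪ volume := withDensity_absolutelyContinuous _ _

theorem weightMeasure_cube (w : EuclideanSpace ℝ (Fin n) → ℝ≥0)
    (x₀ : EuclideanSpace ℝ (Fin n)) (ℓ : ℝ) :
    weightMeasure w (cube x₀ ℓ) = ∫⁻ x in cube x₀ ℓ, w x :=
  withDensity_apply _ (measurableSet_cube x₀ ℓ)

theorem IsWeight.weightMeasure_cube_ne_top {w : EuclideanSpace ℝ (Fin n) → ℝ≥0} (hw : IsWeight w)
    (x₀ : EuclideanSpace ℝ (Fin n)) {ℓ : ℝ} (hℓ : 0 < ℓ) :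
    weightMeasure w (cube x₀ ℓ) ≠ ∞ := by
  have h := (integrableOn_cube hw x₀ hℓ.le).hasFiniteIntegral
  rw [weightMeasure_cube]
  simpa [HasFiniteIntegral, enorm_eq_nnnorm] using h.ne

theorem IsWeight.weightMeasure_cube_ne_zero {w : EuclideanSpace ℝ (Fin n) → ℝ≥0} (hw : IsWeight w)
    (hpos : ∀ᵐ x, 0 < w x) (x₀ : EuclideanSpace ℝ (Fin n)) {ℓ : ℝ} (hℓ : 0 < ℓ) :
    weightMeasure w (cube x₀ ℓ) ≠ 0 := by
  intro h
  refine volume_cube_pos x₀ hℓ (withDensity_absolutelyContinuous' hw.aemeasurable_enn ?_ h)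
  filter_upwards [hpos] with x hx
  simpa using hx.ne'

/-- The fraction of a cube that a subset occupies controls its fraction of an `A_s` weight. -/
theorem IsMuckenhouptWeight.volume_rpow_mul_le {s : ℝ} (hs : 1 < s)
    {w : EuclideanSpace ℝ (Fin n) → ℝ≥0} (hw : IsMuckenhouptWeight s w) :
    ∃ C : ℝ≥0, ∀ (x₀ : EuclideanSpace ℝ (Fin n)) (ℓ : ℝ), 0 < ℓ → ∀ F ⊆ cube x₀ ℓ,
      MeasurableSet F → volume F ^ s * weightMeasure w (cube x₀ ℓ) ≤
        C * volume (cube x₀ ℓ) ^ s * weightMeasure w F := by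
  obtain ⟨hwt, hpos, C, hC⟩ := hw
  refine ⟨C ^ s, fun x₀ ℓ hℓ F hF hFm => ?_⟩
  have hs0 : 0 < s := by linarith
  have hconj : s.HolderConjugate s.conjExponent := Real.HolderConjugate.conjExponent hs
  set s' := s.conjExponent with hs'
  have hs'0 : 0 < s' := hconj.symm.pos
  set V := ∫⁻ x in cube x₀ ℓ, (w x : ℝ≥0∞) ^ (-(s' / s)) with hV
  set Q := volume (cube x₀ ℓ) with hQ
  have hQ0 : Q ≠ 0 := volume_cube_pos x₀ hℓ
  have hQt : Q ≠ ∞ := volume_cube_ne_top x₀ hℓ.le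
  have h1 : volume F ≤ weightMeasure w F ^ (1 / s) * V ^ (1 / s') := by
    -- Hölder is applied to `1 = w^{1/s} w^{-1/s}`, valid since `w > 0` almost everywhere.
    have hsplit : volume F =
        ∫⁻ x in F, ((fun x => (w x : ℝ≥0∞) ^ (1 / s)) * fun x => (w x : ℝ≥0∞) ^ (-(1 / s))) x := by
      rw [← setLIntegral_one]
      refine lintegral_congr_ae (ae_restrict_of_ae ?_)
      filter_upwards [hpos] with x hx
      have hx0 : (w x : ℝ≥0∞) ≠ 0 := by simpa using hx.ne'
      simp only [Pi.mul_apply]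
      rw [← ENNReal.rpow_add _ _ hx0 ENNReal.coe_ne_top]
      simp
    rw [hsplit]
    refine (ENNReal.lintegral_mul_le_Lp_mul_Lq _ hconj
      (hwt.aemeasurable_enn.restrict.pow_const _) (hwt.aemeasurable_enn.restrict.pow_const _)).trans ?_
    gcongr ?_ ^ _ * ?_ ^ _
    · rw [weightMeasure, withDensity_apply _ hFm]
      simp only [← ENNReal.rpow_mul]
      rw [one_div_mul_cancel hs0.ne']
      simp
    · refine (lintegral_mono_set hF).trans (le_of_eq ?_)
      refine lintegral_congr fun x => ?_
      rw [← ENNReal.rpow_mul]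
      congr 1
      ring
  have h2 : weightMeasure w (cube x₀ ℓ) ^ (1 / s) * V ^ (1 / s') ≤ C * Q := by
    have h := hC x₀ ℓ hℓ
    rw [setLAverage_eq, setLAverage_eq, ← weightMeasure_cube,
      ENNReal.div_rpow_of_nonneg _ _ (by positivity),
      ENNReal.div_rpow_of_nonneg _ _ (by positivity)] at h
    have h3 : Q = Q ^ (1 / s) * Q ^ (1 / s') := by
      rw [← ENNReal.rpow_add _ _ hQ0 hQt, one_div, one_div, hconj.inv_add_inv_eq_one,
        ENNReal.rpow_one]
    have ha : Q ^ (1 / s) ≠ 0 := by simp [hQ0, hQt]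
    have hat : Q ^ (1 / s) ≠ ∞ := ENNReal.rpow_ne_top_of_nonneg (by positivity) hQt
    have hb : Q ^ (1 / s') ≠ 0 := by simp [hQ0, hQt]
    have hbt : Q ^ (1 / s') ≠ ∞ := ENNReal.rpow_ne_top_of_nonneg (by positivity) hQt
    calc weightMeasure w (cube x₀ ℓ) ^ (1 / s) * V ^ (1 / s')
        = (Q ^ (1 / s) * (weightMeasure w (cube x₀ ℓ) ^ (1 / s) / Q ^ (1 / s))) *
          (Q ^ (1 / s') * (V ^ (1 / s') / Q ^ (1 / s'))) := by
          rw [ENNReal.mul_div_cancel ha hat, ENNReal.mul_div_cancel hb hbt]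
      _ = (weightMeasure w (cube x₀ ℓ) ^ (1 / s) / Q ^ (1 / s) *
          (V ^ (1 / s') / Q ^ (1 / s'))) * (Q ^ (1 / s) * Q ^ (1 / s')) := by ring
      _ ≤ C * Q := by
          rw [← h3]
          gcongr
  have h4 : volume F * weightMeasure w (cube x₀ ℓ) ^ (1 / s) ≤
      C * Q * weightMeasure w F ^ (1 / s) := by
    calc volume F * weightMeasure w (cube x₀ ℓ) ^ (1 / s)
        ≤ (weightMeasure w F ^ (1 / s) * V ^ (1 / s')) *
            weightMeasure w (cube x₀ ℓ) ^ (1 / s) := by gcongr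
      _ = (weightMeasure w (cube x₀ ℓ) ^ (1 / s) * V ^ (1 / s')) *
            weightMeasure w F ^ (1 / s) := by ring
      _ ≤ _ := by gcongr
  have h5 := ENNReal.rpow_le_rpow h4 hs0.le
  rw [ENNReal.mul_rpow_of_nonneg _ _ hs0.le, ENNReal.mul_rpow_of_nonneg _ _ hs0.le,
    ENNReal.mul_rpow_of_nonneg _ _ hs0.le, ← ENNReal.rpow_mul, ← ENNReal.rpow_mul,
    one_div_mul_cancel hs0.ne', ENNReal.rpow_one, ENNReal.rpow_one] at h5
  rwa [ENNReal.coe_rpow_of_nonneg _ hs0.le]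

theorem IsMuckenhouptWeight.doubling {s : ℝ} (hs : 1 < s)
    {w : EuclideanSpace ℝ (Fin n) → ℝ≥0} (hw : IsMuckenhouptWeight s w) {c : ℝ} (hc : 1 ≤ c) :
    ∃ C : ℝ≥0, ∀ (x₀ : EuclideanSpace ℝ (Fin n)) (ℓ : ℝ), 0 < ℓ →
      weightMeasure w (cube x₀ (c * ℓ)) ≤ C * weightMeasure w (cube x₀ ℓ) := by
  obtain ⟨C, hC⟩ := hw.volume_rpow_mul_le hs
  have hc0 : 0 < c := by linarith
  refine ⟨C * (c.toNNReal ^ n) ^ s, fun x₀ ℓ hℓ => ?_⟩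
  have hs0 : 0 < s := by linarith
  have h := hC x₀ (c * ℓ) (by positivity) (cube x₀ ℓ)
    (cube_subset_cube x₀ (le_mul_of_one_le_left hℓ.le hc)) (measurableSet_cube x₀ ℓ)
  have hQ0 : volume (cube x₀ ℓ) ^ s ≠ 0 := by
    simp [volume_cube_pos x₀ hℓ, hs0.not_gt]
  have hQt : volume (cube x₀ ℓ) ^ s ≠ ∞ :=
    ENNReal.rpow_ne_top_of_nonneg hs0.le (volume_cube_ne_top x₀ hℓ.le)
  rw [volume_cube_mul x₀ x₀ hc0.le hℓ.le, ENNReal.mul_rpow_of_nonneg _ _ hs0.le] at h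
  refine (ENNReal.mul_le_mul_iff_right hQ0 hQt).1 (h.trans (le_of_eq ?_))
  rw [ENNReal.coe_mul, ENNReal.coe_rpow_of_nonneg _ hs0.le, ENNReal.coe_pow]
  simp only [ENNReal.ofReal]
  ring

/-- The complement of `E` has at least half the volume, so it carries at least the fraction `1 / D`
of the weight, with `D = 2 ^ s C`. Taking `D / (D + 1)` instead of `1 - 1 / D` avoids any lower
bound on `D`. -/
theorem IsMuckenhouptWeight.exists_hasHalfDecay {s : ℝ} (hs : 1 < s)
    {w : EuclideanSpace ℝ (Fin n) → ℝ≥0} (hw : IsMuckenhouptWeight s w) :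
    ∃ θ : ℝ≥0, θ < 1 ∧ HasHalfDecay (weightMeasure w) θ := by
  obtain ⟨C, hC⟩ := hw.volume_rpow_mul_le hs
  have hs0 : 0 < s := by linarith
  set D : ℝ≥0 := 2 ^ s * C with hD
  refine ⟨D / (D + 1), (div_lt_one (by positivity)).2 (lt_add_one D), fun x₀ ℓ hℓ E hE hEm hvol => ?_⟩
  set Q := cube x₀ ℓ with hQ
  have hQ0 : volume Q ≠ 0 := volume_cube_pos x₀ hℓ
  have hQt : volume Q ≠ ∞ := volume_cube_ne_top x₀ hℓ.le
  have hEF : volume E + volume (Q \ E) = volume Q := by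
    rw [add_comm, measure_sdiff_add_inter Q hEm |>.symm, inter_eq_self_of_subset_right hE]
  have hEF' : weightMeasure w E + weightMeasure w (Q \ E) = weightMeasure w Q := by
    rw [add_comm, measure_sdiff_add_inter Q hEm |>.symm, inter_eq_self_of_subset_right hE]
  have hF : volume Q ≤ 2 * volume (Q \ E) := by
    have h1 : volume Q + volume Q ≤ volume Q + 2 * volume (Q \ E) := by
      calc volume Q + volume Q = 2 * volume E + 2 * volume (Q \ E) := by
            rw [← mul_add, hEF, two_mul]
        _ ≤ _ := by gcongr
    exact (ENNReal.add_le_add_iff_left hQt).1 h1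
  have h2 : weightMeasure w Q ≤ D * weightMeasure w (Q \ E) := by
    have hQs0 : volume Q ^ s ≠ 0 := by simp [hQ0, hs0.not_gt]
    have hQst : volume Q ^ s ≠ ∞ := ENNReal.rpow_ne_top_of_nonneg hs0.le hQt
    refine (ENNReal.mul_le_mul_iff_right hQs0 hQst).1 ?_
    calc volume Q ^ s * weightMeasure w Q
        ≤ (2 * volume (Q \ E)) ^ s * weightMeasure w Q := by gcongr
      _ = 2 ^ s * (volume (Q \ E) ^ s * weightMeasure w Q) := by
          rw [ENNReal.mul_rpow_of_nonneg _ _ hs0.le, mul_assoc]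
      _ ≤ 2 ^ s * (C * volume Q ^ s * weightMeasure w (Q \ E)) :=
          mul_le_mul_right (hC x₀ ℓ hℓ _ sdiff_subset ((measurableSet_cube x₀ ℓ).diff hEm)) _
      _ = volume Q ^ s * (D * weightMeasure w (Q \ E)) := by
          rw [hD, ENNReal.coe_mul, ENNReal.coe_rpow_of_nonneg _ hs0.le, ENNReal.coe_ofNat]
          ring
  have hqt : weightMeasure w Q ≠ ∞ := hw.1.weightMeasure_cube_ne_top x₀ hℓ
  have het : weightMeasure w E ≠ ∞ := measure_ne_top_of_subset hE hqt
  have hft : weightMeasure w (Q \ E) ≠ ∞ := measure_ne_top_of_subset sdiff_subset hqt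
  generalize weightMeasure w Q = q at *
  generalize weightMeasure w E = e at *
  generalize weightMeasure w (Q \ E) = f at *
  lift q to ℝ≥0 using hqt
  lift e to ℝ≥0 using het
  lift f to ℝ≥0 using hft
  norm_cast at *
  rw [div_mul_eq_mul_div, le_div_iff₀ (by positivity)]
  have h3 : e * (D + 1) + q ≤ D * q + q := by
    calc e * (D + 1) + q ≤ e * (D + 1) + (D * f + f) := by
          gcongr
          exact h2.trans le_self_add
      _ = D * q + q := by rw [← hEF']; ring
  exact le_of_add_le_add_right h3

/-- Powers of the oscillation are integrable, with constants that do not depend on the cube. -/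
theorem exists_oscillation_rpow_le {m : Measure (EuclideanSpace ℝ (Fin n))} (hm : m ≪ volume)
    {θ : ℝ≥0} (hθ1 : θ < 1) (hθ : HasHalfDecay m θ) {b : EuclideanSpace ℝ (Fin n) → 𝕜}
    (hb : LocallyIntegrable b volume) {B : ℝ≥0} (hB : 0 < B) (hosc : MeanOscillationLE b B)
    {p : ℝ} (hp : 0 < p) :
    ∃ C : ℝ≥0, ∀ (x₀ : EuclideanSpace ℝ (Fin n)) (ℓ : ℝ), 0 < ℓ →
      ∫⁻ x in cube x₀ ℓ, (1 + ‖b x - ⨍ y in cube x₀ ℓ, b y‖ₑ) ^ p ∂m ≤ C * m (cube x₀ ℓ) := by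
  -- The constant `M` below is chosen so that `1 + t ≤ M exp (κ t / p)` for `t ≥ 0`.
  obtain ⟨κ, hκ, C, hC⟩ := exists_exp_oscillation_le hm hθ1 hθ hb hB hosc
  set M : ℝ := max 1 (p / κ) with hM
  have hM0 : 0 < M := lt_of_lt_of_le one_pos (le_max_left _ _)
  refine ⟨(M ^ p).toNNReal * C, fun x₀ ℓ hℓ => ?_⟩
  have hpt : ∀ t : ℝ, 0 ≤ t → (1 + t) ^ p ≤ M ^ p * Real.exp (κ * t) := by
    intro t ht
    have h1 : 1 + t ≤ M * Real.exp (κ * t / p) := by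
      have h2 : κ * t / p + 1 ≤ Real.exp (κ * t / p) := Real.add_one_le_exp _
      have h3 : t ≤ M * (κ * t / p) := by
        calc t = p / κ * (κ * t / p) := by field_simp
          _ ≤ M * (κ * t / p) := by gcongr; exact le_max_right _ _
      have h4 : (1 : ℝ) ≤ M := le_max_left _ _
      nlinarith [mul_le_mul_of_nonneg_left h2 hM0.le]
    calc (1 + t) ^ p ≤ (M * Real.exp (κ * t / p)) ^ p := by gcongr
      _ = M ^ p * Real.exp (κ * t) := by
        rw [Real.mul_rpow hM0.le (Real.exp_pos _).le, ← Real.exp_mul]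
        congr 2
        field_simp
  calc ∫⁻ x in cube x₀ ℓ, (1 + ‖b x - ⨍ y in cube x₀ ℓ, b y‖ₑ) ^ p ∂m
      ≤ ∫⁻ x in cube x₀ ℓ, ENNReal.ofReal (M ^ p) *
          ENNReal.ofReal (Real.exp (κ * ‖b x - ⨍ y in cube x₀ ℓ, b y‖)) ∂m := by
        refine lintegral_mono fun x => ?_
        rw [← ENNReal.ofReal_mul (by positivity), ← ofReal_norm, ← ENNReal.ofReal_one,
          ← ENNReal.ofReal_add zero_le_one (norm_nonneg _),
          ENNReal.ofReal_rpow_of_nonneg (by positivity) hp.le]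
        exact ENNReal.ofReal_le_ofReal (hpt _ (norm_nonneg _))
    _ = ENNReal.ofReal (M ^ p) * ∫⁻ x in cube x₀ ℓ,
          ENNReal.ofReal (Real.exp (κ * ‖b x - ⨍ y in cube x₀ ℓ, b y‖)) ∂m :=
        lintegral_const_mul' _ _ ENNReal.ofReal_ne_top
    _ ≤ ENNReal.ofReal (M ^ p) * (C * m (cube x₀ ℓ)) := by
        gcongr
        exact hC x₀ ℓ hℓ
    _ = _ := by
        rw [ENNReal.coe_mul, mul_assoc]
        rfl

end Weights

/-! ### The Orlicz bump against the oscillation of `b`. -/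

section Orlicz

open Filter Topology

variable {n : ℕ} {𝕜 : Type*} [RCLike 𝕜]

/-- A Young inequality by dichotomy: either `u ≤ log (e + t)` and the first term dominates, or `t ≤
exp u` and `u t ≤ exp (2 u)`. -/
theorem ofReal_mul_rpow_le_powLogYoung_add {s : ℝ} (hs : 0 < s) {u : ℝ} (hu : 0 ≤ u) (t : ℝ≥0∞) :
    (ENNReal.ofReal u * t) ^ s ≤ powLogYoung s t + ENNReal.ofReal (Real.exp (2 * s * u)) := by
  induction t with
  | top =>
    have : powLogYoung s ∞ = ∞ := by simp [powLogYoung, hs]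
    simp [this]
  | coe t =>
    rcases le_total u (Real.log (Real.exp 1 + t)) with h | h
    · refine le_trans ?_ le_self_add
      rw [powLogYoung, ← ENNReal.mul_rpow_of_nonneg _ _ hs.le, mul_comm]
      gcongr
      simpa using h
    · refine le_trans ?_ le_add_self
      have ht : (t : ℝ) ≤ Real.exp u := by
        have := (Real.log_le_iff_le_exp (by positivity)).1 h
        linarith [Real.exp_pos 1]
      have h1 : u * t ≤ Real.exp (2 * u) := by
        rw [two_mul, Real.exp_add]
        have : u ≤ Real.exp u := by linarith [Real.add_one_le_exp u]
        gcongr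
      have h2 : ENNReal.ofReal u * t = ENNReal.ofReal (u * t) := by
        rw [ENNReal.ofReal_mul hu]
        simp
      rw [h2, ENNReal.ofReal_rpow_of_nonneg (by positivity) hs.le]
      refine ENNReal.ofReal_le_ofReal ?_
      calc (u * t) ^ s ≤ Real.exp (2 * u) ^ s := by gcongr
        _ = Real.exp (2 * s * u) := by
          rw [← Real.exp_mul]
          ring_nf

/-- A generalised Hölder inequality between the oscillation of `b` and the Luxemburg norm. -/
theorem exists_oscillation_mul_le_luxemburgNorm {b : EuclideanSpace ℝ (Fin n) → 𝕜}
    (hb : LocallyIntegrable b volume) {B : ℝ≥0} (hB : 0 < B) (hosc : MeanOscillationLE b B)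
    {s : ℝ} (hs : 0 < s) :
    ∃ C : ℝ≥0, 0 < C ∧ ∀ (h : EuclideanSpace ℝ (Fin n) → ℝ≥0∞)
      (x₀ : EuclideanSpace ℝ (Fin n)) (ℓ : ℝ), 0 < ℓ →
      (⨍⁻ x in cube x₀ ℓ, ((1 + ‖b x - ⨍ y in cube x₀ ℓ, b y‖ₑ) * h x) ^ s ∂volume) ^ (1 / s) ≤
        C * luxemburgNorm (powLogYoung s) h (cube x₀ ℓ) := by
  obtain ⟨κ₀, hκ₀, C₀, hC₀⟩ := exists_exp_oscillation_le (m := volume)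
    Measure.AbsolutelyContinuous.rfl (θ := 2⁻¹) (by rw [← NNReal.coe_lt_coe]; norm_num)
    hasHalfDecay_volume hb hB hosc
  -- With this choice the exponential in the Young inequality, at `u = 1 + κ G`, is `exp (2 s) exp
  -- (κ₀ G)`, whose average is under control. The factor `M` turns `1 + κ G` back into a bound for
  -- `1 + G`.
  set κ : ℝ := κ₀ / (2 * s) with hκ
  have hκ0 : 0 < κ := by positivity
  set M : ℝ := max 1 (1 / κ) with hM
  have hM1 : 1 ≤ M := le_max_left _ _
  have hM0 : 0 < M := by linarith
  set e : ℝ≥0 := (Real.exp (2 * s)).toNNReal with he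
  refine ⟨M.toNNReal * (1 + e * C₀) ^ (1 / s), by positivity, fun h x₀ ℓ hℓ => ?_⟩
  set Q := cube x₀ ℓ with hQ
  have hQ0 : volume Q ≠ 0 := volume_cube_pos x₀ hℓ
  have hQt : volume Q ≠ ∞ := volume_cube_ne_top x₀ hℓ.le
  set G : EuclideanSpace ℝ (Fin n) → ℝ := fun x => ‖b x - ⨍ y in Q, b y‖ with hG
  set C : ℝ≥0 := M.toNNReal * (1 + e * C₀) ^ (1 / s) with hC
  have hCpos : 0 < C := by positivity
  rw [mul_comm, ← ENNReal.div_le_iff_le_mul (Or.inl (by simpa using hCpos.ne'))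
    (Or.inl ENNReal.coe_ne_top)]
  -- It suffices to test every admissible `t` in the Luxemburg infimum.
  refine le_iInf₂ fun t ht => ?_
  obtain ⟨ht0, ht1⟩ := ht
  refine ENNReal.div_le_of_le_mul ?_
  have htn : (t : ℝ≥0∞) ≠ 0 := by simpa using ht0.ne'
  have hpt : ∀ x, ((1 + ‖b x - ⨍ y in Q, b y‖ₑ) * h x) ^ s ≤
      (ENNReal.ofReal M * t) ^ s * (powLogYoung s (h x / t) +
        e * ENNReal.ofReal (Real.exp (κ₀ * G x))) := by
    intro x
    have h1 : 1 + ‖b x - ⨍ y in Q, b y‖ₑ ≤ ENNReal.ofReal M * ENNReal.ofReal (1 + κ * G x) := by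
      rw [← ENNReal.ofReal_mul hM0.le, ← ofReal_norm, ← ENNReal.ofReal_one,
          ← ENNReal.ofReal_add zero_le_one (norm_nonneg _)]
      refine ENNReal.ofReal_le_ofReal ?_
      have h2 : G x ≤ M * (κ * G x) := by
        calc G x = 1 / κ * (κ * G x) := by field_simp
          _ ≤ M * (κ * G x) := by
            have : 0 ≤ G x := norm_nonneg _
            gcongr
            exact le_max_right _ _
      have h3 : ‖b x - ⨍ y in Q, b y‖ = G x := rfl
      rw [h3]
      linarith
    have h2 : h x = t * (h x / t) := (ENNReal.mul_div_cancel htn ENNReal.coe_ne_top).symm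
    calc ((1 + ‖b x - ⨍ y in Q, b y‖ₑ) * h x) ^ s
        ≤ ((ENNReal.ofReal M * ENNReal.ofReal (1 + κ * G x)) * (t * (h x / t))) ^ s := by
          rw [← h2]
          gcongr
      _ = (ENNReal.ofReal M * t) ^ s * (ENNReal.ofReal (1 + κ * G x) * (h x / t)) ^ s := by
          rw [← ENNReal.mul_rpow_of_nonneg _ _ hs.le]
          congr 1
          ring
      _ ≤ (ENNReal.ofReal M * t) ^ s * (powLogYoung s (h x / t) +
            ENNReal.ofReal (Real.exp (2 * s * (1 + κ * G x)))) := by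
          gcongr
          exact ofReal_mul_rpow_le_powLogYoung_add hs
            (add_nonneg zero_le_one (mul_nonneg hκ0.le (norm_nonneg _))) _
      _ = _ := by
          congr 2
          have h3 : 2 * s * (1 + κ * G x) = 2 * s + κ₀ * G x := by
            rw [hκ]
            field_simp
          rw [h3, Real.exp_add, ENNReal.ofReal_mul (Real.exp_pos _).le]
          rfl
  have hexp : ⨍⁻ x in Q, e * ENNReal.ofReal (Real.exp (κ₀ * G x)) ∂volume ≤ e * C₀ := by
    rw [setLAverage_eq, lintegral_const_mul' _ _ ENNReal.coe_ne_top, mul_div_assoc]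
    gcongr
    exact ENNReal.div_le_of_le_mul (hC₀ x₀ ℓ hℓ)
  have hmeas : AEMeasurable (fun x => (e : ℝ≥0∞) * ENNReal.ofReal (Real.exp (κ₀ * G x)))
      volume := by
    have h1 : AEMeasurable G volume :=
      (hb.aestronglyMeasurable.sub aestronglyMeasurable_const).norm.aemeasurable
    exact (((h1.const_mul κ₀).exp).ennreal_ofReal).const_mul _
  have havg : ⨍⁻ x in Q, ((1 + ‖b x - ⨍ y in Q, b y‖ₑ) * h x) ^ s ∂volume ≤
      (ENNReal.ofReal M * t) ^ s * (1 + e * C₀) := by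
    calc ⨍⁻ x in Q, ((1 + ‖b x - ⨍ y in Q, b y‖ₑ) * h x) ^ s ∂volume
        ≤ ⨍⁻ x in Q, (ENNReal.ofReal M * t) ^ s * (powLogYoung s (h x / t) +
          e * ENNReal.ofReal (Real.exp (κ₀ * G x))) ∂volume := lintegral_mono hpt
      _ = (ENNReal.ofReal M * t) ^ s * (⨍⁻ x in Q, powLogYoung s (h x / t) ∂volume +
          ⨍⁻ x in Q, e * ENNReal.ofReal (Real.exp (κ₀ * G x)) ∂volume) := by
          simp only [laverage]
          rw [lintegral_const_mul' _ _ (ENNReal.rpow_ne_top_of_nonneg hs.le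
            (ENNReal.mul_ne_top ENNReal.ofReal_ne_top ENNReal.coe_ne_top)),
            lintegral_add_right' _ (hmeas.restrict.smul_measure _)]
      _ ≤ _ := by gcongr
  calc (⨍⁻ x in Q, ((1 + ‖b x - ⨍ y in Q, b y‖ₑ) * h x) ^ s ∂volume) ^ (1 / s)
      ≤ ((ENNReal.ofReal M * t) ^ s * (1 + e * C₀)) ^ (1 / s) := by gcongr
    _ = t * C := by
      rw [ENNReal.mul_rpow_of_nonneg _ _ (by positivity), ← ENNReal.rpow_mul,
        mul_one_div_cancel hs.ne', ENNReal.rpow_one, hC, ENNReal.coe_mul,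
        ENNReal.coe_rpow_of_nonneg _ (by positivity : 0 ≤ 1 / s)]
      push_cast
      rw [ENNReal.ofReal]
      ring

theorem laverage_cube_le_rpow {r : ℝ} (hr : 1 < r) {f : EuclideanSpace ℝ (Fin n) → ℝ≥0∞}
    (hf : AEMeasurable f volume) (x₀ : EuclideanSpace ℝ (Fin n)) {ℓ : ℝ} (hℓ : 0 < ℓ) :
    ⨍⁻ x in cube x₀ ℓ, f x ∂volume ≤ (⨍⁻ x in cube x₀ ℓ, f x ^ r ∂volume) ^ (1 / r) := by
  have h := ENNReal.lintegral_mul_le_Lp_mul_Lq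
    (μ := (volume.restrict (cube x₀ ℓ) univ)⁻¹ • volume.restrict (cube x₀ ℓ))
    (Real.HolderConjugate.conjExponent hr) (f := f) (g := fun _ => 1)
    (hf.restrict.smul_measure _) aemeasurable_const
  have hQ0 : volume (cube x₀ ℓ) ≠ 0 := volume_cube_pos x₀ hℓ
  have hQt : volume (cube x₀ ℓ) ≠ ∞ := volume_cube_ne_top x₀ hℓ.le
  simpa [laverage, ENNReal.inv_mul_cancel hQ0 hQt] using h

/-- The form in which the bump condition is used. -/
theorem OrliczBump.exists_laverage_oscillation_mul_le {p r : ℝ} (hp : 1 < p) (hr : 1 < r)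
    {w ν : EuclideanSpace ℝ (Fin n) → ℝ≥0} (hw : IsWeight w) (hwpos : ∀ᵐ x, 0 < w x)
    (hν : IsWeight ν) (hbump : OrliczBump p r w ν) {b : EuclideanSpace ℝ (Fin n) → 𝕜}
    (hb : LocallyIntegrable b volume) {B : ℝ≥0} (hB : 0 < B) (hosc : MeanOscillationLE b B) :
    ∃ C : ℝ≥0, ∀ f : EuclideanSpace ℝ (Fin n) → 𝕜, AEStronglyMeasurable f volume →
      ∀ (x₀ : EuclideanSpace ℝ (Fin n)) (ℓ : ℝ), 0 < ℓ →
      weightMeasure w (cube x₀ ℓ) ^ (1 / p) *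
        ⨍⁻ x in cube x₀ ℓ, (1 + ‖b x - ⨍ y in cube x₀ ℓ, b y‖ₑ) * ‖f x‖ₑ ∂volume ≤
        C * (∫⁻ x in cube x₀ ℓ, ‖f x‖ₑ ^ p * ν x) ^ (1 / p) := by
  have hp0 : 0 < p := by linarith
  have hconj : p.HolderConjugate p.conjExponent := Real.HolderConjugate.conjExponent hp
  set s := p.conjExponent with hs
  have hs0 : 0 < s := hconj.symm.pos
  obtain ⟨C₁, hC₁0, hC₁⟩ := exists_oscillation_mul_le_luxemburgNorm hb hB hosc hs0
  obtain ⟨C₂, hC₂⟩ := hbump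
  refine ⟨C₁ * C₂, fun f hf x₀ ℓ hℓ => ?_⟩
  set Q := cube x₀ ℓ with hQ
  have hQ0 : volume Q ≠ 0 := volume_cube_pos x₀ hℓ
  have hQt : volume Q ≠ ∞ := volume_cube_ne_top x₀ hℓ.le
  set g : EuclideanSpace ℝ (Fin n) → ℝ≥0∞ := fun x => 1 + ‖b x - ⨍ y in Q, b y‖ₑ with hg
  have hgm : AEMeasurable g volume :=
    (hb.aestronglyMeasurable.sub aestronglyMeasurable_const).enorm.const_add 1
  set h : EuclideanSpace ℝ (Fin n) → ℝ≥0∞ := fun x => (ν x : ℝ≥0∞) ^ (-(1 / p)) with hh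
  have hhm : AEMeasurable h volume := hν.aemeasurable_enn.pow_const _
  have key := hC₁ h x₀ ℓ hℓ
  have hbQ := hC₂ x₀ ℓ hℓ
  set lux := luxemburgNorm (powLogYoung s) h Q with hlux
  set W := ⨍⁻ x in Q, (w x : ℝ≥0∞) ^ r ∂volume with hW
  have hlaw := laverage_cube_le_rpow hr hw.aemeasurable_enn x₀ hℓ
  have hwQ : weightMeasure w Q = volume Q * ⨍⁻ x in Q, (w x : ℝ≥0∞) ∂volume := by
    rw [weightMeasure_cube, setLAverage_eq, ENNReal.mul_div_cancel hQ0 hQt]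
  -- Nonvanishing of this factor lets the bump condition force the Luxemburg norm to be finite, as
  -- `0 * ∞ = 0` would hide an infinite one.
  have hW0 : W ^ (1 / (r * p)) ≠ 0 := by
    have h1 : W ≠ 0 := by
      intro h0
      have h2 : ⨍⁻ x in Q, (w x : ℝ≥0∞) ∂volume = 0 := by
        rw [← hQ, ← hW, h0, ENNReal.zero_rpow_of_pos (by positivity)] at hlaw
        exact le_antisymm hlaw (zero_le)
      exact hw.weightMeasure_cube_ne_zero hwpos x₀ hℓ (by rw [← hQ, hwQ, h2, mul_zero])
    have h2 : 0 < 1 / (r * p) := by positivity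
    simp only [ne_eq, ENNReal.rpow_eq_zero_iff]
    rintro (⟨h3, -⟩ | ⟨-, h3⟩)
    · exact h1 h3
    · linarith
  have hluxt : lux ≠ ∞ := by
    intro ht
    rw [ht, ENNReal.mul_top hW0] at hbQ
    exact absurd hbQ (by simp)
  have havgt : ⨍⁻ x in Q, (g x * h x) ^ s ∂volume ≠ ∞ := by
    intro ht
    rw [ht, ENNReal.top_rpow_of_pos (by positivity)] at key
    exact absurd key (not_le.2 (ENNReal.mul_lt_top ENNReal.coe_lt_top hluxt.lt_top))
  have hint : ∫⁻ x in Q, (g x * h x) ^ s = volume Q * ⨍⁻ x in Q, (g x * h x) ^ s ∂volume := by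
    rw [setLAverage_eq, ENNReal.mul_div_cancel hQ0 hQt]
  -- A finite integral of `(g h)^s` with `g ≥ 1` excludes `h = ∞`, that is `ν = 0`, on a set of
  -- positive measure. Hence `ν^{1/p} h = 1` almost everywhere on `Q`, and Hölder applies.
  have hνpos : ∀ᵐ x ∂volume.restrict Q, ν x ≠ 0 := by
    have h1 : ∫⁻ x in Q, (g x * h x) ^ s ≠ ∞ := by
      rw [hint]
      exact ENNReal.mul_ne_top hQt havgt
    filter_upwards [ae_lt_top' ((hgm.mul hhm).pow_const s).restrict h1] with x hx h0
    have h2 : h x = ∞ := by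
      have : -(1 / p) < 0 := by
        have : 0 < 1 / p := by positivity
        linarith
      simp only [hh, h0, ENNReal.coe_zero, ENNReal.zero_rpow_of_neg this]
    have h3 : g x ≠ 0 := by simp [hg]
    simp only [Pi.mul_apply, h2, ENNReal.mul_top h3, ENNReal.top_rpow_of_pos hs0] at hx
    exact lt_irrefl _ hx
  have hholder : ∫⁻ x in Q, g x * ‖f x‖ₑ ≤ (∫⁻ x in Q, ‖f x‖ₑ ^ p * ν x) ^ (1 / p) *
      (∫⁻ x in Q, (g x * h x) ^ s) ^ (1 / s) := by
    have hsplit : ∫⁻ x in Q, g x * ‖f x‖ₑ = ∫⁻ x in Q,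
        ((fun x => ‖f x‖ₑ * (ν x : ℝ≥0∞) ^ (1 / p)) * fun x => g x * h x) x := by
      refine lintegral_congr_ae ?_
      filter_upwards [hνpos] with x hx
      have h1 : (ν x : ℝ≥0∞) ^ (1 / p) * h x = 1 := by
        rw [hh, ← ENNReal.rpow_add _ _ (by simpa using hx) ENNReal.coe_ne_top]
        simp
      calc g x * ‖f x‖ₑ = (g x * ‖f x‖ₑ) * ((ν x : ℝ≥0∞) ^ (1 / p) * h x) := by rw [h1, mul_one]
        _ = _ := by simp only [Pi.mul_apply]; ring
    rw [hsplit]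
    refine (ENNReal.lintegral_mul_le_Lp_mul_Lq _ hconj
      (hf.enorm.mul (hν.aemeasurable_enn.pow_const _)).restrict (hgm.mul hhm).restrict).trans ?_
    refine mul_le_mul' (ENNReal.rpow_le_rpow (lintegral_mono fun x => le_of_eq ?_)
      (by positivity)) le_rfl
    simp only [Pi.mul_apply]
    rw [ENNReal.mul_rpow_of_nonneg _ _ hp0.le, ← ENNReal.rpow_mul, one_div_mul_cancel hp0.ne',
      ENNReal.rpow_one]
  set N := (∫⁻ x in Q, ‖f x‖ₑ ^ p * ν x) ^ (1 / p) with hN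
  have hQpow : volume Q ^ (1 / p) * volume Q ^ (1 / s) = volume Q := by
    rw [← ENNReal.rpow_add _ _ hQ0 hQt, one_div, one_div, hconj.inv_add_inv_eq_one,
      ENNReal.rpow_one]
  -- Jensen's inequality: the exponent `r` in the bump is only used through the plain average of
  -- `w`.
  have hwle : weightMeasure w Q ^ (1 / p) ≤ volume Q ^ (1 / p) * W ^ (1 / (r * p)) := by
    rw [hwQ, ENNReal.mul_rpow_of_nonneg _ _ (by positivity)]
    gcongr
    calc (⨍⁻ x in Q, (w x : ℝ≥0∞) ∂volume) ^ (1 / p) ≤ (W ^ (1 / r)) ^ (1 / p) := by gcongr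
      _ = W ^ (1 / (r * p)) := by
        rw [← ENNReal.rpow_mul]
        congr 1
        field_simp
  rw [setLAverage_eq, ← mul_div_assoc]
  refine ENNReal.div_le_of_le_mul ?_
  calc weightMeasure w Q ^ (1 / p) * ∫⁻ x in Q, g x * ‖f x‖ₑ
      ≤ (volume Q ^ (1 / p) * W ^ (1 / (r * p))) * (N * (volume Q ^ (1 / s) * (C₁ * lux))) := by
        gcongr
        refine hholder.trans ?_
        gcongr
        rw [hint, ENNReal.mul_rpow_of_nonneg _ _ (by positivity)]
        gcongr
    _ = C₁ * (W ^ (1 / (r * p)) * lux) * N * (volume Q ^ (1 / p) * volume Q ^ (1 / s)) := by ring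
    _ ≤ C₁ * C₂ * N * (volume Q ^ (1 / p) * volume Q ^ (1 / s)) := by gcongr
    _ = _ := by rw [hQpow, ENNReal.coe_mul]

end Orlicz

/-! ### Minkowski's inequality for countable sums. -/

section Minkowski

open Filter Topology

/-- Monotone convergence for finite `q`; for `q = ∞` a countable union of null sets is discarded. It
passes from partial sums to the series. -/
theorem eLpNorm_iSup_nat_le {X : Type*} [MeasurableSpace X] {m : Measure X} {q : ℝ≥0∞} (hq : 1 ≤ q)
    {g : ℕ → X → ℝ≥0∞} (hg : ∀ j, AEMeasurable (g j) m) (hmono : ∀ x, Monotone fun j => g j x)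
    {C : ℝ≥0∞} (hC : ∀ j, eLpNorm (g j) q m ≤ C) :
    eLpNorm (fun x => ⨆ j, g j x) q m ≤ C := by
  rcases eq_or_ne q ∞ with rfl | hqt
  · rw [eLpNorm_exponent_top]
    refine eLpNormEssSup_le_of_ae_enorm_bound ?_
    have h : ∀ᵐ x ∂m, ∀ j, ‖g j x‖ₑ ≤ eLpNormEssSup (g j) m :=
      ae_all_iff.2 fun j => ae_le_eLpNormEssSup
    filter_upwards [h] with x hx
    simp only [enorm_eq_self] at hx ⊢
    exact iSup_le fun j => (hx j).trans (hC j)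
  · have hq0 : q ≠ 0 := (zero_lt_one.trans_le hq).ne'
    have hqr : 0 < q.toReal := ENNReal.toReal_pos hq0 hqt
    rw [eLpNorm_eq_lintegral_rpow_enorm_toReal hq0 hqt]
    simp only [enorm_eq_self]
    rw [← ENNReal.le_rpow_inv_iff (by positivity)]
    have h1 : ∀ x, (⨆ j, g j x) ^ q.toReal = ⨆ j, g j x ^ q.toReal := fun x =>
      (ENNReal.orderIsoRpow q.toReal hqr).map_iSup _
    simp only [h1]
    rw [lintegral_iSup' (fun j => (hg j).pow_const _)
      (ae_of_all _ fun x i j hij => ENNReal.rpow_le_rpow (hmono x hij) hqr.le)]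
    refine iSup_le fun j => ?_
    rw [ENNReal.le_rpow_inv_iff (by positivity)]
    have := hC j
    rw [eLpNorm_eq_lintegral_rpow_enorm_toReal hq0 hqt] at this
    simpa only [enorm_eq_self] using this

/-- **Minkowski's inequality** for series of non-negative functions. -/
theorem eLpNorm_tsum_nat_le {X : Type*} [MeasurableSpace X] {m : Measure X} {q : ℝ≥0∞} (hq : 1 ≤ q)
    {g : ℕ → X → ℝ≥0∞} (hg : ∀ j, AEMeasurable (g j) m) :
    eLpNorm (fun x => ∑' j, g j x) q m ≤ ∑' j, eLpNorm (g j) q m := by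
  simp only [ENNReal.tsum_eq_iSup_nat (f := fun j => g j _)]
  refine eLpNorm_iSup_nat_le hq (fun j => Finset.aemeasurable_fun_sum _ fun i _ => hg i)
    (fun x i j hij => Finset.sum_le_sum_of_subset (Finset.range_mono hij)) fun j => ?_
  have := eLpNorm_sum_le (s := Finset.range j) (fun i _ => (hg i).aestronglyMeasurable) hq
  refine le_trans (le_of_eq ?_) (this.trans (ENNReal.sum_le_tsum _))
  congr 1
  ext x
  simp

end Minkowski

/-! ### Measurability in the centre of the cube, and weak norms. -/

section Norms

open Filter Topology

variable {n : ℕ} {𝕜 : Type*} [RCLike 𝕜]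

/-- The cubes are the sections of one closed subset of the product space. -/
theorem measurable_measure_cube (m : Measure (EuclideanSpace ℝ (Fin n))) [SFinite m] (ℓ : ℝ) :
    Measurable fun y => m (cube y ℓ) := by
  have h : MeasurableSet {z : EuclideanSpace ℝ (Fin n) × EuclideanSpace ℝ (Fin n) |
      ∀ i, |z.2 i - z.1 i| ≤ ℓ / 2} := by
    have : {z : EuclideanSpace ℝ (Fin n) × EuclideanSpace ℝ (Fin n) |
      ∀ i, |z.2 i - z.1 i| ≤ ℓ / 2} = ⋂ i, {z | |z.2 i - z.1 i| ≤ ℓ / 2} := by ext; simp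
    rw [this]
    exact (isClosed_iInter fun i => isClosed_le (by fun_prop) continuous_const).measurableSet
  exact measurable_measure_prodMk_left h

theorem lintegral_weightMeasure {ν : EuclideanSpace ℝ (Fin n) → ℝ≥0} (hν : IsWeight ν)
    {s : Set (EuclideanSpace ℝ (Fin n))} (hs : MeasurableSet s)
    (g : EuclideanSpace ℝ (Fin n) → ℝ≥0∞) :
    ∫⁻ x in s, g x ∂weightMeasure ν = ∫⁻ x in s, g x * ν x := by
  rw [weightMeasure, setLIntegral_withDensity_eq_setLIntegral_mul_non_measurable₀ _
    hν.aemeasurable_enn.restrict _ hs (ae_of_all _ fun x => ENNReal.coe_lt_top)]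
  simp only [Pi.mul_apply, mul_comm]

theorem eLpNorm_indicator_cube {p : ℝ} (hp : 0 < p) {ν : EuclideanSpace ℝ (Fin n) → ℝ≥0}
    (hν : IsWeight ν) (f : EuclideanSpace ℝ (Fin n) → 𝕜) (y : EuclideanSpace ℝ (Fin n)) (ℓ : ℝ) :
    eLpNorm ((cube y ℓ).indicator f) (ENNReal.ofReal p) (weightMeasure ν) =
      (∫⁻ x in cube y ℓ, ‖f x‖ₑ ^ p * ν x) ^ (1 / p) := by
  rw [eLpNorm_indicator_eq_eLpNorm_restrict (measurableSet_cube y ℓ),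
    eLpNorm_eq_lintegral_rpow_enorm_toReal (by simpa using hp) ENNReal.ofReal_ne_top,
    ENNReal.toReal_ofReal hp.le, lintegral_weightMeasure hν (measurableSet_cube y ℓ)]

/-- The norm is a power of the mass that the measure `|f|^p ν dx` gives to the cube, so no
measurability of `f` enters. -/
theorem measurable_eLpNorm_indicator_cube {p : ℝ} (hp : 0 < p)
    {ν : EuclideanSpace ℝ (Fin n) → ℝ≥0} (hν : IsWeight ν) (f : EuclideanSpace ℝ (Fin n) → 𝕜)
    (ℓ : ℝ) : Measurable fun y => eLpNorm ((cube y ℓ).indicator f) (ENNReal.ofReal p)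
      (weightMeasure ν) := by
  simp only [eLpNorm_indicator_cube hp hν]
  have h := measurable_measure_cube (volume.withDensity fun x => ‖f x‖ₑ ^ p * (ν x : ℝ≥0∞)) ℓ
  simp only [withDensity_apply _ (measurableSet_cube _ ℓ)] at h
  exact h.pow_const _

/-- A sum exceeds `σ` only where a summand exceeds `σ / 2`, whence the factor `2`; `t ↦ t^{1/p}` is
subadditive as `p ≥ 1`. -/
theorem weakLpNorm_le_two_mul_add {p : ℝ} (hp : 1 < p) (w : EuclideanSpace ℝ (Fin n) → ℝ≥0)
    {h h₁ h₂ : EuclideanSpace ℝ (Fin n) → 𝕜} (hle : ∀ᵐ x, ‖h x‖ ≤ ‖h₁ x‖ + ‖h₂ x‖) :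
    weakLpNorm p w h ≤ 2 * (weakLpNorm p w h₁ + weakLpNorm p w h₂) := by
  have hp0 : 0 < p := by linarith
  refine iSup₂_le fun σ hσ => ?_
  have hσ2 : 0 < σ / 2 := by positivity
  have hsub : {x | σ < ‖h x‖₊} ≤ᵐ[weightMeasure w]
      ({x | σ / 2 < ‖h₁ x‖₊} ∪ {x | σ / 2 < ‖h₂ x‖₊} : Set _) := by
    filter_upwards [(weightMeasure_absolutelyContinuous w).ae_le hle] with x hx hxσ
    have hxσ' : (σ : ℝ) < ‖h x‖ := hxσ
    by_contra hcon
    have hcon' : ¬ (σ / 2 < ‖h₁ x‖₊ ∨ σ / 2 < ‖h₂ x‖₊) := hcon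
    push Not at hcon'
    have h1 : ‖h₁ x‖ ≤ (σ : ℝ) / 2 := by exact_mod_cast hcon'.1
    have h2 : ‖h₂ x‖ ≤ (σ : ℝ) / 2 := by exact_mod_cast hcon'.2
    linarith
  have hp1 : 1 / p ≤ 1 := by
    rw [div_le_one hp0]
    exact hp.le
  calc (σ : ℝ≥0∞) * weightMeasure w {x | σ < ‖h x‖₊} ^ (1 / p)
      ≤ σ * (weightMeasure w {x | σ / 2 < ‖h₁ x‖₊} ^ (1 / p) +
          weightMeasure w {x | σ / 2 < ‖h₂ x‖₊} ^ (1 / p)) := by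
        gcongr
        refine (ENNReal.rpow_le_rpow ((measure_mono_ae hsub).trans (measure_union_le _ _))
          (by positivity)).trans ?_
        exact ENNReal.rpow_add_le_add_rpow _ _ (by positivity) hp1
    _ = 2 * (((σ / 2 : ℝ≥0) : ℝ≥0∞) * weightMeasure w {x | σ / 2 < ‖h₁ x‖₊} ^ (1 / p) +
          ((σ / 2 : ℝ≥0) : ℝ≥0∞) * weightMeasure w {x | σ / 2 < ‖h₂ x‖₊} ^ (1 / p)) := by
        have : (σ : ℝ≥0∞) = 2 * ((σ / 2 : ℝ≥0) : ℝ≥0∞) := by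
          norm_cast
          rw [mul_div_cancel₀]
          norm_num
        rw [this]
        ring
    _ ≤ _ := by
        gcongr
        · exact le_iSup₂_of_le (σ / 2) hσ2 le_rfl
        · exact le_iSup₂_of_le (σ / 2) hσ2 le_rfl

theorem weakLpNorm_indicator_le {p : ℝ} (hp : 0 < p) (w : EuclideanSpace ℝ (Fin n) → ℝ≥0)
    (s : Set (EuclideanSpace ℝ (Fin n))) (h : EuclideanSpace ℝ (Fin n) → 𝕜) :
    weakLpNorm p w (s.indicator h) ≤ weakLpNorm p w h := by
  refine iSup₂_mono fun σ _ => ?_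
  gcongr with x hx
  exact norm_indicator_le_norm_self h x

/-- **Chebyshev's inequality** for a function dominated on `s` by a multiple of `g`. -/
theorem weakLpNorm_indicator_le_of_enorm_le {p : ℝ} (hp : 0 < p)
    (w : EuclideanSpace ℝ (Fin n) → ℝ≥0) {s : Set (EuclideanSpace ℝ (Fin n))}
    (hs : MeasurableSet s) {h : EuclideanSpace ℝ (Fin n) → 𝕜}
    {g : EuclideanSpace ℝ (Fin n) → ℝ≥0∞} (hg : AEMeasurable g volume) (S : ℝ≥0∞)
    (hle : ∀ᵐ x, x ∈ s → ‖h x‖ₑ ≤ S * g x) :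
    weakLpNorm p w (s.indicator h) ≤ S * (∫⁻ x in s, g x ^ p ∂weightMeasure w) ^ (1 / p) := by
  have hac := weightMeasure_absolutelyContinuous w
  refine iSup₂_le fun σ hσ => ?_
  have hgm : AEMeasurable (fun x => g x ^ p) ((weightMeasure w).restrict s) :=
    ((hg.mono_ac hac).restrict).pow_const _
  have hcheb := mul_meas_ge_le_lintegral₀ (hgm.const_mul (S ^ p)) ((σ : ℝ≥0∞) ^ p)
  rw [lintegral_const_mul'' _ hgm] at hcheb
  have hsub : weightMeasure w {x | σ < ‖s.indicator h x‖₊} ≤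
      (weightMeasure w).restrict s {x | (σ : ℝ≥0∞) ^ p ≤ S ^ p * g x ^ p} := by
    rw [Measure.restrict_apply' hs]
    refine measure_mono_ae ?_
    filter_upwards [hac.ae_le hle] with x hx hxσ
    have hxσ' : σ < ‖s.indicator h x‖₊ := hxσ
    have hxs : x ∈ s := by
      by_contra hcon
      simp [indicator_of_notMem hcon] at hxσ'
    rw [indicator_of_mem hxs] at hxσ'
    refine ⟨?_, hxs⟩
    change (σ : ℝ≥0∞) ^ p ≤ S ^ p * g x ^ p
    rw [← ENNReal.mul_rpow_of_nonneg _ _ hp.le]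
    refine ENNReal.rpow_le_rpow (le_trans ?_ (hx hxs)) hp.le
    rw [enorm_eq_nnnorm]
    exact_mod_cast hxσ'.le
  have hroot : ∀ a : ℝ≥0∞, (a ^ p) ^ (1 / p) = a := fun a => by
    rw [← ENNReal.rpow_mul, mul_one_div_cancel hp.ne', ENNReal.rpow_one]
  calc (σ : ℝ≥0∞) * weightMeasure w {x | σ < ‖s.indicator h x‖₊} ^ (1 / p)
      = ((σ : ℝ≥0∞) ^ p * weightMeasure w {x | σ < ‖s.indicator h x‖₊}) ^ (1 / p) := by
        rw [ENNReal.mul_rpow_of_nonneg _ _ (by positivity), hroot]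
    _ ≤ (S ^ p * ∫⁻ x in s, g x ^ p ∂weightMeasure w) ^ (1 / p) := by
        refine ENNReal.rpow_le_rpow (le_trans ?_ hcheb) (by positivity)
        gcongr
    _ = _ := by rw [ENNReal.mul_rpow_of_nonneg _ _ (by positivity), hroot]

theorem weakLpNorm_le_of_forall_measure_le {p : ℝ} (hp : 0 < p)
    (w : EuclideanSpace ℝ (Fin n) → ℝ≥0) {h : EuclideanSpace ℝ (Fin n) → 𝕜} {C : ℝ≥0} {I : ℝ≥0∞}
    (hle : ∀ σ : ℝ≥0, 0 < σ → weightMeasure w {x | σ < ‖h x‖₊} ≤ C / (σ : ℝ≥0∞) ^ p * I) :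
    weakLpNorm p w h ≤ (C : ℝ≥0∞) ^ (1 / p) * I ^ (1 / p) := by
  refine iSup₂_le fun σ hσ => ?_
  have hσ0 : (σ : ℝ≥0∞) ≠ 0 := by simpa using hσ.ne'
  have hσp0 : (σ : ℝ≥0∞) ^ p ≠ 0 := by simp [hσ0]
  have hσpt : (σ : ℝ≥0∞) ^ p ≠ ∞ := ENNReal.rpow_ne_top_of_nonneg hp.le ENNReal.coe_ne_top
  have hroot : ((σ : ℝ≥0∞) ^ p) ^ (1 / p) = σ := by
    rw [← ENNReal.rpow_mul, mul_one_div_cancel hp.ne', ENNReal.rpow_one]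
  calc (σ : ℝ≥0∞) * weightMeasure w {x | σ < ‖h x‖₊} ^ (1 / p)
      = ((σ : ℝ≥0∞) ^ p * weightMeasure w {x | σ < ‖h x‖₊}) ^ (1 / p) := by
        rw [ENNReal.mul_rpow_of_nonneg _ _ (by positivity), hroot]
    _ ≤ ((σ : ℝ≥0∞) ^ p * (C / (σ : ℝ≥0∞) ^ p * I)) ^ (1 / p) := by
        gcongr
        exact hle σ hσ
    _ = _ := by
        rw [← mul_assoc, ENNReal.mul_div_cancel hσp0 hσpt,
          ENNReal.mul_rpow_of_nonneg _ _ (by positivity)]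

end Norms

/-! ### Dyadic annuli and the commutator kernel. -/

section Annuli

open Filter Topology

variable {n : ℕ} {𝕜 : Type*} [RCLike 𝕜]

/-- The side length of `2 ^ (j + 1) Q` for a cube `Q ⊆ ℝⁿ` with side length `ℓ`. -/
noncomputable def dilatedSide (n : ℕ) (ℓ : ℝ) (j : ℕ) : ℝ := 2 ^ j * (2 * √(n : ℝ) * ℓ)

theorem dilatedSide_zero (n : ℕ) (ℓ : ℝ) : dilatedSide n ℓ 0 = 2 * √(n : ℝ) * ℓ := by
  simp [dilatedSide]

theorem dilatedSide_succ (n : ℕ) (ℓ : ℝ) (j : ℕ) :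
    dilatedSide n ℓ (j + 1) = 2 * dilatedSide n ℓ j := by
  simp only [dilatedSide, pow_succ]
  ring

theorem one_le_sqrt_natCast (hn : 1 ≤ n) : 1 ≤ √(n : ℝ) := by
  rw [Real.one_le_sqrt]
  exact_mod_cast hn

theorem dilatedSide_pos (hn : 1 ≤ n) {ℓ : ℝ} (hℓ : 0 < ℓ) (j : ℕ) : 0 < dilatedSide n ℓ j := by
  have := one_le_sqrt_natCast hn
  unfold dilatedSide
  positivity

theorem two_mul_le_dilatedSide (hn : 1 ≤ n) {ℓ : ℝ} (hℓ : 0 < ℓ) (j : ℕ) :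
    2 * ℓ ≤ dilatedSide n ℓ j := by
  have h1 := one_le_sqrt_natCast hn
  have h2 : (1 : ℝ) ≤ 2 ^ j := one_le_pow₀ one_le_two
  calc 2 * ℓ = 1 * (2 * 1 * ℓ) := by ring
    _ ≤ dilatedSide n ℓ j := by
      unfold dilatedSide
      gcongr

/-- Puts `x ∈ Q` outside the closed support of a function that vanishes on `2Q`, as the size
condition requires. -/
theorem cube_dilatedSide_zero_mem_nhds (hn : 1 ≤ n) {x y : EuclideanSpace ℝ (Fin n)} {ℓ : ℝ}
    (hℓ : 0 < ℓ) (hx : x ∈ cube y ℓ) : cube y (dilatedSide n ℓ 0) ∈ 𝓝 x := by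
  have hopen : IsOpen (⋂ i, {z : EuclideanSpace ℝ (Fin n) |
      |z i - y i| < dilatedSide n ℓ 0 / 2}) :=
    isOpen_iInter_of_finite fun i => isOpen_lt (by fun_prop) continuous_const
  refine mem_of_superset (hopen.mem_nhds (mem_iInter.2 fun i => ?_)) fun z hz i => ?_
  · have h1 := hx i
    have h2 := two_mul_le_dilatedSide hn hℓ 0
    change |x i - y i| < dilatedSide n ℓ 0 / 2
    linarith
  · exact le_of_lt (mem_iInter.1 hz i)

/-- In some coordinate `z` is farther than `L_j / 2` from `y`, while `x` is within `ℓ / 2 ≤ L_j /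
4`. So `‖x - z‖ ≥ L_j / 4 = L_{j+1} / 8`. -/
theorem dilatedSide_succ_le_norm_sub (hn : 1 ≤ n) {x y z : EuclideanSpace ℝ (Fin n)} {ℓ : ℝ}
    (hℓ : 0 < ℓ) (hx : x ∈ cube y ℓ) {j : ℕ} (hz : z ∉ cube y (dilatedSide n ℓ j)) :
    dilatedSide n ℓ (j + 1) ≤ 8 * ‖x - z‖ := by
  simp only [cube, mem_ofPred_eq, not_forall, not_le] at hz
  obtain ⟨i, hi⟩ := hz
  have h1 := hx i
  have h2 := two_mul_le_dilatedSide hn hℓ j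
  have h3 : |x i - z i| ≤ ‖x - z‖ := PiLp.norm_apply_le (x - z) i
  have h4 : |z i - y i| ≤ |x i - z i| + |x i - y i| := by
    rw [abs_sub_comm (x i) (z i)]
    exact abs_sub_le _ _ _
  rw [dilatedSide_succ]
  linarith

theorem exists_mem_cube_dilatedSide (hn : 1 ≤ n) (y z : EuclideanSpace ℝ (Fin n)) {ℓ : ℝ}
    (hℓ : 0 < ℓ) : ∃ j, z ∈ cube y (dilatedSide n ℓ j) := by
  obtain ⟨j, hj⟩ := pow_unbounded_of_one_lt (2 * ‖z - y‖ / dilatedSide n ℓ 0) one_lt_two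
  refine ⟨j, fun i => ?_⟩
  have h3 : |z i - y i| ≤ ‖z - y‖ := PiLp.norm_apply_le (z - y) i
  have h0 := dilatedSide_pos hn hℓ 0
  rw [div_lt_iff₀ h0] at hj
  have h4 : dilatedSide n ℓ j = 2 ^ j * dilatedSide n ℓ 0 := by simp [dilatedSide]
  rw [h4]
  linarith

/-- Dyadic decomposition of a fractional kernel away from a cube. -/
theorem lintegral_div_enorm_sub_pow_le (hn : 1 ≤ n) {x y : EuclideanSpace ℝ (Fin n)} {ℓ : ℝ}
    (hℓ : 0 < ℓ) (hx : x ∈ cube y ℓ) {φ : EuclideanSpace ℝ (Fin n) → ℝ≥0∞}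
    (hφ : ∀ z ∈ cube y (dilatedSide n ℓ 0), φ z = 0) :
    ∫⁻ z, φ z / ‖x - z‖ₑ ^ n ≤
      8 ^ n * ∑' j : ℕ, ⨍⁻ z in cube y (dilatedSide n ℓ (j + 1)), φ z ∂volume := by
  set Q : ℕ → Set (EuclideanSpace ℝ (Fin n)) := fun j => cube y (dilatedSide n ℓ j) with hQ
  -- The least `j` with `z ∈ Q j` decides which piece contains `z`.
  have hcover : (univ : Set (EuclideanSpace ℝ (Fin n))) ⊆ Q 0 ∪ ⋃ j, Q (j + 1) \ Q j := by
    intro z _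
    classical
    have hex := exists_mem_cube_dilatedSide hn y z hℓ
    rcases hj : Nat.find hex with _ | j
    · left
      have := Nat.find_spec hex
      rwa [hj] at this
    · right
      refine mem_iUnion.2 ⟨j, ?_, ?_⟩
      · have := Nat.find_spec hex
        rwa [hj] at this
      · exact Nat.find_min hex (by omega)
  have h0 : ∫⁻ z in Q 0, φ z / ‖x - z‖ₑ ^ n = 0 := by
    rw [setLIntegral_congr_fun (g := fun _ => 0) (measurableSet_cube _ _)
      fun z hz => by simp [hφ z hz]]
    simp
  have hpiece : ∀ j, ∫⁻ z in Q (j + 1) \ Q j, φ z / ‖x - z‖ₑ ^ n ≤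
      8 ^ n * ⨍⁻ z in Q (j + 1), φ z ∂volume := by
    intro j
    have hL := dilatedSide_pos hn hℓ (j + 1)
    have hV0 := volume_cube_pos y hL
    have hVt := volume_cube_ne_top y hL.le
    have hpt : ∀ z ∈ Q (j + 1) \ Q j, φ z / ‖x - z‖ₑ ^ n ≤
        8 ^ n / volume (Q (j + 1)) * φ z := by
      intro z hz
      have h1 := dilatedSide_succ_le_norm_sub hn hℓ hx hz.2
      have h2 : volume (Q (j + 1)) ≤ 8 ^ n * ‖x - z‖ₑ ^ n := by
        rw [hQ, volume_cube y hL.le, ← mul_pow, ← ofReal_norm]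
        gcongr
        calc ENNReal.ofReal (dilatedSide n ℓ (j + 1)) ≤ ENNReal.ofReal (8 * ‖x - z‖) :=
              ENNReal.ofReal_le_ofReal h1
          _ = 8 * ENNReal.ofReal ‖x - z‖ := by
              rw [ENNReal.ofReal_mul (by norm_num)]
              simp
      have h3 : (‖x - z‖ₑ ^ n)⁻¹ ≤ 8 ^ n / volume (Q (j + 1)) := by
        rw [ENNReal.le_div_iff_mul_le (Or.inl hV0) (Or.inl hVt), mul_comm, ← div_eq_mul_inv]
        exact ENNReal.div_le_of_le_mul h2
      rw [div_eq_mul_inv, mul_comm]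
      gcongr
    have hct : (8 : ℝ≥0∞) ^ n / volume (Q (j + 1)) ≠ ∞ :=
      ENNReal.div_ne_top (ENNReal.pow_ne_top (by simp)) hV0
    calc ∫⁻ z in Q (j + 1) \ Q j, φ z / ‖x - z‖ₑ ^ n
        ≤ ∫⁻ z in Q (j + 1) \ Q j, 8 ^ n / volume (Q (j + 1)) * φ z :=
          setLIntegral_mono' ((measurableSet_cube _ _).diff (measurableSet_cube _ _)) hpt
      _ ≤ ∫⁻ z in Q (j + 1), 8 ^ n / volume (Q (j + 1)) * φ z := lintegral_mono_set sdiff_subset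
      _ = 8 ^ n * ⨍⁻ z in Q (j + 1), φ z ∂volume := by
          rw [lintegral_const_mul' _ _ hct, setLAverage_eq]
          simp only [div_eq_mul_inv]
          ring
  calc ∫⁻ z, φ z / ‖x - z‖ₑ ^ n
      = ∫⁻ z in univ, φ z / ‖x - z‖ₑ ^ n := by rw [setLIntegral_univ]
    _ ≤ ∫⁻ z in Q 0 ∪ ⋃ j, Q (j + 1) \ Q j, φ z / ‖x - z‖ₑ ^ n := lintegral_mono_set hcover
    _ ≤ (∫⁻ z in Q 0, φ z / ‖x - z‖ₑ ^ n) +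
          ∫⁻ z in ⋃ j, Q (j + 1) \ Q j, φ z / ‖x - z‖ₑ ^ n := lintegral_union_le _ _ _
    _ ≤ 0 + ∑' j, ∫⁻ z in Q (j + 1) \ Q j, φ z / ‖x - z‖ₑ ^ n := by
        rw [h0]
        gcongr
        exact lintegral_iUnion_le _ _
    _ ≤ ∑' j, 8 ^ n * ⨍⁻ z in Q (j + 1), φ z ∂volume := by
        rw [zero_add]
        exact ENNReal.tsum_le_tsum hpiece
    _ = _ := ENNReal.tsum_mul_left

theorem enorm_setAverage_sub_setAverage_le {b : EuclideanSpace ℝ (Fin n) → 𝕜}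
    (hb : LocallyIntegrable b volume) {B : ℝ≥0} (hosc : MeanOscillationLE b B)
    (y : EuclideanSpace ℝ (Fin n)) {c ℓ : ℝ} (hc : 1 ≤ c) (hℓ : 0 < ℓ) :
    ‖(⨍ x in cube y ℓ, b x) - ⨍ x in cube y (c * ℓ), b x‖ₑ ≤ ENNReal.ofReal c ^ n * B := by
  have hc0 : 0 < c := by linarith
  refine (enorm_setAverage_sub_le hb y hℓ _).trans ?_
  refine (laverage_cube_le_of_subset _ hc0 hℓ
    (LE.le.eventuallyLE (cube_subset_cube y (le_mul_of_one_le_left hℓ.le hc)))).trans ?_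
  gcongr
  exact hosc y (c * ℓ) (by positivity)

/-- Telescoping: the step from `Q` to `2Q` dilates by `2 √n`, each later one by `2`, and a dilation
by `c` moves the mean by at most `c ^ n B`. -/
theorem enorm_setAverage_sub_dilated_le (hn : 1 ≤ n) {b : EuclideanSpace ℝ (Fin n) → 𝕜}
    (hb : LocallyIntegrable b volume) {B : ℝ≥0} (hosc : MeanOscillationLE b B)
    (y : EuclideanSpace ℝ (Fin n)) {ℓ : ℝ} (hℓ : 0 < ℓ) (j : ℕ) :
    ‖(⨍ x in cube y ℓ, b x) - ⨍ x in cube y (dilatedSide n ℓ j), b x‖ₑ ≤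
      (ENNReal.ofReal (2 * √(n : ℝ)) ^ n + j * 2 ^ n) * B := by
  induction j with
  | zero =>
    have h1 := one_le_sqrt_natCast hn
    rw [dilatedSide_zero]
    simpa using enorm_setAverage_sub_setAverage_le hb hosc y (by linarith : 1 ≤ 2 * √(n : ℝ)) hℓ
  | succ j ih =>
    have h2 := enorm_setAverage_sub_setAverage_le hb hosc y one_le_two (dilatedSide_pos hn hℓ j)
    rw [← dilatedSide_succ] at h2
    have h3 : (⨍ x in cube y ℓ, b x) - ⨍ x in cube y (dilatedSide n ℓ (j + 1)), b x =
        ((⨍ x in cube y ℓ, b x) - ⨍ x in cube y (dilatedSide n ℓ j), b x) +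
        ((⨍ x in cube y (dilatedSide n ℓ j), b x) -
          ⨍ x in cube y (dilatedSide n ℓ (j + 1)), b x) := by ring
    rw [h3]
    refine (enorm_add_le _ _).trans ((add_le_add ih h2).trans (le_of_eq ?_))
    rw [ENNReal.ofReal_ofNat]
    push_cast
    ring

/-- The commutator integral of a function that vanishes near a cube. -/
theorem lintegral_commutator_kernel_le (hn : 1 ≤ n) {b : EuclideanSpace ℝ (Fin n) → 𝕜}
    (hb : LocallyIntegrable b volume) {B : ℝ≥0} (hosc : MeanOscillationLE b B)
    {x y : EuclideanSpace ℝ (Fin n)} {ℓ : ℝ} (hℓ : 0 < ℓ) (hx : x ∈ cube y ℓ)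
    {f g : EuclideanSpace ℝ (Fin n) → 𝕜} (hgf : ∀ z, ‖g z‖ₑ ≤ ‖f z‖ₑ)
    (hg : ∀ z ∈ cube y (dilatedSide n ℓ 0), g z = 0) :
    ∫⁻ z, ‖b x - b z‖ₑ * ‖g z‖ₑ / ‖x - z‖ₑ ^ n ≤
      8 ^ n * (1 + ‖b x - ⨍ z in cube y ℓ, b z‖ₑ) *
        ∑' j : ℕ, (1 + (ENNReal.ofReal (2 * √(n : ℝ)) ^ n + (j + 1 : ℕ) * 2 ^ n) * B) *
          ⨍⁻ z in cube y (dilatedSide n ℓ (j + 1)),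
            (1 + ‖b z - ⨍ u in cube y (dilatedSide n ℓ (j + 1)), b u‖ₑ) * ‖f z‖ₑ ∂volume := by
  refine (lintegral_div_enorm_sub_pow_le hn hℓ hx fun z hz => by simp [hg z hz]).trans ?_
  rw [mul_assoc]
  refine mul_le_mul_right ?_ _
  rw [← ENNReal.tsum_mul_left]
  refine ENNReal.tsum_le_tsum fun j => ?_
  set bQ := ⨍ z in cube y ℓ, b z
  set bj := ⨍ u in cube y (dilatedSide n ℓ (j + 1)), b u
  have hbb := enorm_setAverage_sub_dilated_le hn hb hosc y hℓ (j + 1)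
  set a : ℝ≥0∞ := (ENNReal.ofReal (2 * √(n : ℝ)) ^ n + (j + 1 : ℕ) * 2 ^ n) * B with ha
  have hat : a ≠ ∞ := by
    refine ENNReal.mul_ne_top (ENNReal.add_ne_top.2 ⟨ENNReal.pow_ne_top ENNReal.ofReal_ne_top,
      ENNReal.mul_ne_top (ENNReal.natCast_ne_top _) (ENNReal.pow_ne_top (by simp))⟩) (by simp)
  have hpt : ∀ z, ‖b x - b z‖ₑ * ‖g z‖ₑ ≤
      ((1 + ‖b x - bQ‖ₑ) * (1 + a)) * ((1 + ‖b z - bj‖ₑ) * ‖f z‖ₑ) := by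
    intro z
    have h1 : b x - b z = (b x - bQ) + (bQ - bj) + (bj - b z) := by ring
    have h2 : ‖b x - b z‖ₑ ≤ ‖b x - bQ‖ₑ + a + ‖b z - bj‖ₑ := by
      rw [h1]
      refine (enorm_add_le _ _).trans ?_
      rw [enorm_sub_rev bj (b z)]
      gcongr
      refine (enorm_add_le _ _).trans ?_
      gcongr
    -- Bounding the sum by a product separates the dependence on `x` from that on `z`.
    have h3 : ‖b x - bQ‖ₑ + a + ‖b z - bj‖ₑ ≤
        (1 + ‖b x - bQ‖ₑ) * (1 + a) * (1 + ‖b z - bj‖ₑ) := by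
      generalize ‖b x - bQ‖ₑ = s
      generalize ‖b z - bj‖ₑ = t
      have : (1 + s) * (1 + a) * (1 + t) =
          (s + a + t) + (1 + s * a + s * t + a * t + s * a * t) := by ring
      rw [this]
      exact le_self_add
    rw [← mul_assoc]
    exact mul_le_mul' (h2.trans h3) (hgf z)
  refine (lintegral_mono hpt).trans (le_of_eq ?_)
  rw [lintegral_const_mul' _ _ (ENNReal.mul_ne_top (by simp) (by simp [hat])), mul_assoc]
  rfl

end Annuli

/-! ### The local estimate on one cube. -/

section Local

open Filter Topology

variable {n : ℕ} {𝕜 : Type*} [RCLike 𝕜]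

/-- The constant of the `j`-th annulus: the growth of the means of `b` against the decay
of the weight. -/
noncomputable def annulusCoeff (n : ℕ) (B ρ : ℝ≥0) (j : ℕ) : ℝ≥0∞ :=
  (1 + (ENNReal.ofReal (2 * √(n : ℝ)) ^ n + (j + 1 : ℕ) * 2 ^ n) * B) * (ρ : ℝ≥0∞) ^ (j + 1)

theorem tsum_annulusCoeff_ne_top (n : ℕ) (B : ℝ≥0) {ρ : ℝ≥0} (hρ : ρ < 1) :
    ∑' j, annulusCoeff n B ρ j ≠ ∞ := by
  set A : ℝ≥0 := (2 * √(n : ℝ)).toNNReal ^ n with hA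
  have h : ∀ j, annulusCoeff n B ρ j =
      (((1 + (A + (j + 1 : ℕ) * 2 ^ n) * B) * ρ ^ (j + 1) : ℝ≥0) : ℝ≥0∞) := by
    intro j
    simp only [annulusCoeff, hA, ENNReal.ofReal]
    push_cast
    rfl
  simp only [h]
  rw [ENNReal.tsum_coe_ne_top_iff_summable]
  have hρ' : ‖(ρ : ℝ)‖ < 1 := by simpa using hρ
  have h0 := (summable_pow_mul_geometric_of_norm_lt_one 0 hρ').mul_left ((1 + A * B : ℝ≥0) : ℝ)
  have h1 := (summable_pow_mul_geometric_of_norm_lt_one 1 hρ').mul_left ((2 ^ n * B : ℝ≥0) : ℝ)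
  have h2 : Summable fun j : ℕ => (1 + ((A : ℝ) + j * 2 ^ n) * B) * (ρ : ℝ) ^ j := by
    refine (h0.add h1).congr fun j => ?_
    push_cast
    ring
  have h3 := (summable_nat_add_iff 1).2 h2
  rw [← NNReal.summable_coe]
  refine h3.congr fun j => ?_
  push_cast
  rfl

/-- As `n ≥ 1`, each dilate has at most half the volume of the next, so half decay iterates. -/
theorem HasHalfDecay.measure_cube_le_pow {m : Measure (EuclideanSpace ℝ (Fin n))} {θ : ℝ≥0}
    (hθ : HasHalfDecay m θ) (hn : 1 ≤ n) (y : EuclideanSpace ℝ (Fin n)) {ℓ : ℝ} (hℓ : 0 < ℓ)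
    (j : ℕ) : m (cube y ℓ) ≤ θ ^ j * m (cube y (dilatedSide n ℓ j)) := by
  induction j with
  | zero =>
    have := two_mul_le_dilatedSide hn hℓ 0
    simpa using measure_mono (cube_subset_cube y (by linarith))
  | succ j ih =>
    have hL := dilatedSide_pos hn hℓ j
    have h := hθ y (dilatedSide n ℓ (j + 1)) (dilatedSide_pos hn hℓ _)
      (cube y (dilatedSide n ℓ j))
      (cube_subset_cube y (by rw [dilatedSide_succ]; linarith)) (measurableSet_cube _ _) (by
        rw [dilatedSide_succ, volume_cube_mul y y zero_le_two hL.le]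
        gcongr
        rw [ENNReal.ofReal_ofNat]
        exact le_self_pow₀ one_le_two (by omega))
    calc m (cube y ℓ) ≤ θ ^ j * m (cube y (dilatedSide n ℓ j)) := ih
      _ ≤ θ ^ j * (θ * m (cube y (dilatedSide n ℓ (j + 1)))) := by gcongr
      _ = _ := by ring

theorem rpow_le_of_le_mul_of_nonpos {a b : ℝ≥0∞} {D : ℝ≥0} {E : ℝ} (hE : E ≤ 0) (ha0 : a ≠ 0)
    (hat : a ≠ ∞) (hb0 : b ≠ 0) (hbt : b ≠ ∞) (h : a ≤ D * b) :
    b ^ E ≤ (D : ℝ≥0∞) ^ (-E) * a ^ E := by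
  have h1 : a ^ (-E) ≤ (D : ℝ≥0∞) ^ (-E) * b ^ (-E) := by
    rw [← ENNReal.mul_rpow_of_nonneg _ _ (by linarith)]
    exact ENNReal.rpow_le_rpow h (by linarith)
  have h2 : ∀ c : ℝ≥0∞, c ≠ 0 → c ≠ ∞ → c ^ (-E) * c ^ E = 1 := fun c h0 ht => by
    rw [← ENNReal.rpow_add _ _ h0 ht]
    simp
  calc b ^ E = (a ^ (-E) * a ^ E) * b ^ E := by rw [h2 a ha0 hat, one_mul]
    _ ≤ (((D : ℝ≥0∞) ^ (-E) * b ^ (-E)) * a ^ E) * b ^ E := by gcongr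
    _ = ((D : ℝ≥0∞) ^ (-E) * a ^ E) * (b ^ (-E) * b ^ E) := by ring
    _ = _ := by rw [h2 b hb0 hbt, mul_one]

/-- The local estimate: the weak norm of `T f` on a cube is dominated by the weighted norms of
`f` on the dilates of this cube. -/
theorem exists_weakLpNorm_indicator_le {p r : ℝ} (hn : 1 ≤ n) (hp : 1 < p) (hr : 1 < r)
    {w ν : EuclideanSpace ℝ (Fin n) → ℝ≥0} (hw : IsAInftyWeight w) (hν : IsWeight ν)
    (hbump : OrliczBump p r w ν) {b : EuclideanSpace ℝ (Fin n) → 𝕜} (hb : IsBMO b)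
    {D : Submodule 𝕜 (EuclideanSpace ℝ (Fin n) → 𝕜)}
    (hDloc : ∀ f ∈ D, LocallyIntegrable f volume)
    (hDcpt : ∀ f : EuclideanSpace ℝ (Fin n) → 𝕜,
      Integrable f volume → HasCompactSupport f → f ∈ D)
    {T : (EuclideanSpace ℝ (Fin n) → 𝕜) → EuclideanSpace ℝ (Fin n) → 𝕜}
    (hT : IsSublinearOn D T) (hsize : CommutatorSizeCondition D b T)
    (hweak : WeakTypeBound D p w ν T) {E : ℝ} (hE : E ≤ 0) (hE' : 0 < E + 1 / p) :
    ∃ (K₁ K₂ B ρ : ℝ≥0), ρ < 1 ∧ ∀ f ∈ D, ∀ (y : EuclideanSpace ℝ (Fin n)) (ℓ : ℝ), 0 < ℓ →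
      weightMeasure w (cube y ℓ) ^ E * weakLpNorm p w ((cube y ℓ).indicator (T f)) ≤
        K₁ * (weightMeasure w (cube y (dilatedSide n ℓ 0)) ^ E *
          eLpNorm ((cube y (dilatedSide n ℓ 0)).indicator f) (ENNReal.ofReal p)
            (weightMeasure ν)) +
        K₂ * ∑' j, annulusCoeff n B ρ j *
          (weightMeasure w (cube y (dilatedSide n ℓ (j + 1))) ^ E *
            eLpNorm ((cube y (dilatedSide n ℓ (j + 1))).indicator f) (ENNReal.ofReal p)
              (weightMeasure ν)) := by
  have hp0 : 0 < p := by linarith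
  obtain ⟨s, hs, hws⟩ := hw
  have hwt : IsWeight w := hws.1
  have hwpos := hws.2.1
  obtain ⟨hbloc, B₀, hB₀⟩ := hb
  -- Adding `1` makes the bound positive, as the stopping height `2B` must be.
  set B : ℝ≥0 := B₀ + 1 with hB
  have hBpos : 0 < B := by positivity
  have hosc : MeanOscillationLE b B := fun x₀ ℓ hℓ =>
    (hB₀ x₀ ℓ hℓ).trans (by exact_mod_cast le_self_add)
  have h1s := one_le_sqrt_natCast hn
  obtain ⟨Cd, hCd⟩ := hws.doubling hs (c := 2 * √(n : ℝ)) (by linarith)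
  obtain ⟨θ, hθ1, hθ⟩ := hws.exists_hasHalfDecay hs
  have hac := weightMeasure_absolutelyContinuous w
  obtain ⟨Cp, hCp⟩ := exists_oscillation_rpow_le hac hθ1 hθ hbloc hBpos hosc hp0
  obtain ⟨Ch, hCh⟩ := hbump.exists_laverage_oscillation_mul_le hp hr hwt hwpos hν hbloc hBpos hosc
  obtain ⟨Cs, hCs⟩ := hsize
  obtain ⟨Cw, hCw⟩ := hweak
  set δ : ℝ := E + 1 / p with hδ
  refine ⟨2 * (Cd ^ (-E) * Cw ^ (1 / p)), 2 * (Cs * 8 ^ n * Cp ^ (1 / p) * Ch), B, θ ^ δ,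
    NNReal.rpow_lt_one hθ1 hE', fun f hf y ℓ hℓ => ?_⟩
  have hm0 : ∀ {l : ℝ}, 0 < l → weightMeasure w (cube y l) ≠ 0 := fun hl =>
    hwt.weightMeasure_cube_ne_zero hwpos y hl
  have hmt : ∀ {l : ℝ}, 0 < l → weightMeasure w (cube y l) ≠ ∞ := fun hl =>
    hwt.weightMeasure_cube_ne_top y hl
  set L : ℕ → ℝ := dilatedSide n ℓ with hL
  have hLpos : ∀ j, 0 < L j := dilatedSide_pos hn hℓ
  set Q := cube y ℓ with hQ
  set N : ℕ → ℝ≥0∞ := fun j => eLpNorm ((cube y (L j)).indicator f) (ENNReal.ofReal p)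
    (weightMeasure ν) with hN
  have hNeq : ∀ j, N j = (∫⁻ x in cube y (L j), ‖f x‖ₑ ^ p * ν x) ^ (1 / p) := fun j =>
    eLpNorm_indicator_cube hp0 hν f y (L j)
  have hfloc := hDloc f hf
  set f₁ := (cube y (L 0)).indicator f with hf₁
  have hf₁D : f₁ ∈ D := by
    refine hDcpt _ ?_ ?_
    · exact (integrable_indicator_iff (measurableSet_cube _ _)).2
        (integrableOn_cube hfloc y (hLpos 0).le)
    · exact HasCompactSupport.intro (isCompact_cube y (hLpos 0).le)
        fun x hx => indicator_of_notMem hx f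
  set f₂ := f - f₁ with hf₂
  have hf₂D : f₂ ∈ D := D.sub_mem hf hf₁D
  have hf₂0 : ∀ z ∈ cube y (L 0), f₂ z = 0 := fun z hz => by
    simp [hf₂, hf₁, indicator_of_mem hz]
  have hf₂le : ∀ z, ‖f₂ z‖ₑ ≤ ‖f z‖ₑ := by
    intro z
    by_cases hz : z ∈ cube y (L 0)
    · simp [hf₂0 z hz]
    · simp [hf₂, hf₁, indicator_of_notMem hz]
  have hsplit : weakLpNorm p w (Q.indicator (T f)) ≤
      2 * (weakLpNorm p w (Q.indicator (T f₁)) + weakLpNorm p w (Q.indicator (T f₂))) := by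
    refine weakLpNorm_le_two_mul_add hp w ?_
    have h := hT.norm_add_le f₁ hf₁D f₂ hf₂D
    rw [hf₂, add_sub_cancel] at h
    filter_upwards [h] with x hx
    by_cases hxQ : x ∈ Q
    · simpa only [indicator_of_mem hxQ] using hx
    · simp [indicator_of_notMem hxQ]
  have hlocal : weakLpNorm p w (Q.indicator (T f₁)) ≤ (Cw : ℝ≥0∞) ^ (1 / p) * N 0 := by
    refine (weakLpNorm_indicator_le hp0 w Q _).trans ?_
    refine (weakLpNorm_le_of_forall_measure_le hp0 w fun σ hσ => hCw f₁ hf₁D σ hσ).trans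
      (le_of_eq ?_)
    rw [hNeq 0, ← lintegral_indicator (measurableSet_cube _ _)]
    congr 3
    ext x
    by_cases hx : x ∈ cube y (L 0)
    · simp [hf₁, indicator_of_mem hx]
    · simp [hf₁, indicator_of_notMem hx, hp0]
  set a : ℕ → ℝ≥0∞ := fun j =>
    1 + (ENNReal.ofReal (2 * √(n : ℝ)) ^ n + (j + 1 : ℕ) * 2 ^ n) * B with ha
  have hav : ∀ j, ⨍⁻ z in cube y (L (j + 1)),
      (1 + ‖b z - ⨍ u in cube y (L (j + 1)), b u‖ₑ) * ‖f z‖ₑ ∂volume ≤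
        Ch * (weightMeasure w (cube y (L (j + 1))) ^ (-(1 / p)) * N (j + 1)) := by
    intro j
    have h := hCh f hfloc.aestronglyMeasurable y (L (j + 1)) (hLpos _)
    rw [← hNeq] at h
    set W := weightMeasure w (cube y (L (j + 1))) with hW
    have hWW : W ^ (-(1 / p)) * W ^ (1 / p) = 1 := by
      rw [← ENNReal.rpow_add _ _ (hm0 (hLpos _)) (hmt (hLpos _))]
      simp
    calc _ = W ^ (-(1 / p)) * (W ^ (1 / p) * ⨍⁻ z in cube y (L (j + 1)),
            (1 + ‖b z - ⨍ u in cube y (L (j + 1)), b u‖ₑ) * ‖f z‖ₑ ∂volume) := by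
          rw [← mul_assoc, hWW, one_mul]
      _ ≤ W ^ (-(1 / p)) * (Ch * N (j + 1)) := by gcongr
      _ = _ := by ring
  set S : ℝ≥0∞ := ∑' j, a j * (weightMeasure w (cube y (L (j + 1))) ^ (-(1 / p)) * N (j + 1))
    with hS
  -- The sum `S` does not depend on `x`; Chebyshev leaves only the `L^p(w)` norm of the oscillation
  -- over `Q`.
  have hglobal : weakLpNorm p w (Q.indicator (T f₂)) ≤
      (Cs * 8 ^ n * Ch * S) * ((Cp : ℝ≥0∞) ^ (1 / p) * weightMeasure w Q ^ (1 / p)) := by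
    have hgm : AEMeasurable (fun x => 1 + ‖b x - ⨍ z in Q, b z‖ₑ) volume :=
      (hbloc.aestronglyMeasurable.sub aestronglyMeasurable_const).enorm.const_add 1
    refine (weakLpNorm_indicator_le_of_enorm_le hp0 w (measurableSet_cube y ℓ) hgm
      (Cs * 8 ^ n * Ch * S) ?_).trans ?_
    · filter_upwards [hCs f₂ hf₂D] with x hx hxQ
      have hsupp : x ∉ tsupport f₂ := by
        rw [notMem_tsupport_iff_eventuallyEq]
        filter_upwards [cube_dilatedSide_zero_mem_nhds hn hℓ hxQ] with z hz using hf₂0 z hz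
      have hker := lintegral_commutator_kernel_le hn hbloc hosc hℓ hxQ hf₂le hf₂0
      calc ‖T f₂ x‖ₑ ≤ Cs * ∫⁻ z, ‖b x - b z‖ₑ * ‖f₂ z‖ₑ / ‖x - z‖ₑ ^ n := hx hsupp
        _ ≤ Cs * (8 ^ n * (1 + ‖b x - ⨍ z in Q, b z‖ₑ) * ∑' j, a j *
              (Ch * (weightMeasure w (cube y (L (j + 1))) ^ (-(1 / p)) * N (j + 1)))) := by
            refine mul_le_mul_right (hker.trans ?_) _
            refine mul_le_mul_right (ENNReal.tsum_le_tsum fun j => ?_) _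
            exact mul_le_mul_right (hav j) _
        _ = Cs * 8 ^ n * Ch * S * (1 + ‖b x - ⨍ z in Q, b z‖ₑ) := by
            have : ∀ j, a j *
                (Ch * (weightMeasure w (cube y (L (j + 1))) ^ (-(1 / p)) * N (j + 1))) =
                Ch * (a j *
                  (weightMeasure w (cube y (L (j + 1))) ^ (-(1 / p)) * N (j + 1))) := fun j => by
              ring
            simp only [this]
            rw [ENNReal.tsum_mul_left, ← hS]
            ring
    · gcongr
      rw [← ENNReal.mul_rpow_of_nonneg _ _ (by positivity)]
      exact ENNReal.rpow_le_rpow (hCp y ℓ hℓ) (by positivity)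
  have hpow₁ : weightMeasure w Q ^ E ≤
      (Cd : ℝ≥0∞) ^ (-E) * weightMeasure w (cube y (L 0)) ^ E := by
    refine rpow_le_of_le_mul_of_nonpos hE (hm0 (hLpos 0)) (hmt (hLpos 0)) (hm0 hℓ) (hmt hℓ) ?_
    rw [hL, dilatedSide_zero]
    exact hCd y ℓ hℓ
  -- Half decay to the power `δ > 0` trades `w(Q)^δ` for `θ^{δ j} w(Q_j)^δ`, and `δ - 1/p = E`
  -- restores the amalgam exponent.
  have hpow₂ : ∀ j, weightMeasure w Q ^ δ * (weightMeasure w (cube y (L j)) ^ (-(1 / p))) ≤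
      ((θ ^ δ : ℝ≥0) : ℝ≥0∞) ^ j * weightMeasure w (cube y (L j)) ^ E := by
    intro j
    have h := ENNReal.rpow_le_rpow (hθ.measure_cube_le_pow hn y hℓ j) hE'.le
    rw [ENNReal.mul_rpow_of_nonneg _ _ hE'.le, ← ENNReal.rpow_natCast, ← ENNReal.rpow_mul,
      mul_comm (j : ℝ), ENNReal.rpow_mul, ENNReal.rpow_natCast] at h
    rw [ENNReal.coe_rpow_of_nonneg _ hE'.le]
    have hEδ : weightMeasure w (cube y (L j)) ^ E = weightMeasure w (cube y (L j)) ^ δ *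
        weightMeasure w (cube y (L j)) ^ (-(1 / p)) := by
      rw [← ENNReal.rpow_add _ _ (hm0 (hLpos j)) (hmt (hLpos j))]
      congr 1
      rw [hδ]
      ring
    rw [hEδ, ← mul_assoc]
    gcongr
  have hQδ : weightMeasure w Q ^ E * weightMeasure w Q ^ (1 / p) = weightMeasure w Q ^ δ := by
    rw [← ENNReal.rpow_add _ _ (hm0 hℓ) (hmt hℓ)]
  have hsum : weightMeasure w Q ^ δ * S ≤ ∑' j, annulusCoeff n B (θ ^ δ) j *
      (weightMeasure w (cube y (L (j + 1))) ^ E * N (j + 1)) := by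
    rw [hS, ← ENNReal.tsum_mul_left]
    refine ENNReal.tsum_le_tsum fun j => ?_
    calc weightMeasure w Q ^ δ *
          (a j * (weightMeasure w (cube y (L (j + 1))) ^ (-(1 / p)) * N (j + 1)))
        = a j * (weightMeasure w Q ^ δ * weightMeasure w (cube y (L (j + 1))) ^ (-(1 / p))) *
            N (j + 1) := by ring
      _ ≤ a j * (((θ ^ δ : ℝ≥0) : ℝ≥0∞) ^ (j + 1) *
            weightMeasure w (cube y (L (j + 1))) ^ E) * N (j + 1) := by
          exact mul_le_mul' (mul_le_mul' le_rfl (hpow₂ (j + 1))) le_rfl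
      _ = _ := by
          rw [annulusCoeff]
          ring
  calc weightMeasure w Q ^ E * weakLpNorm p w (Q.indicator (T f))
      ≤ weightMeasure w Q ^ E * (2 * ((Cw : ℝ≥0∞) ^ (1 / p) * N 0 +
          (Cs * 8 ^ n * Ch * S) * ((Cp : ℝ≥0∞) ^ (1 / p) * weightMeasure w Q ^ (1 / p)))) := by
        gcongr
        exact hsplit.trans (by gcongr)
    _ = 2 * (weightMeasure w Q ^ E * (Cw : ℝ≥0∞) ^ (1 / p) * N 0) +
          2 * (Cs * 8 ^ n * (Cp : ℝ≥0∞) ^ (1 / p) * Ch) *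
            (weightMeasure w Q ^ E * weightMeasure w Q ^ (1 / p) * S) := by ring
    _ ≤ 2 * ((Cd : ℝ≥0∞) ^ (-E) * weightMeasure w (cube y (L 0)) ^ E *
            (Cw : ℝ≥0∞) ^ (1 / p) * N 0) +
          2 * (Cs * 8 ^ n * (Cp : ℝ≥0∞) ^ (1 / p) * Ch) *
            ∑' j, annulusCoeff n B (θ ^ δ) j *
              (weightMeasure w (cube y (L (j + 1))) ^ E * N (j + 1)) := by
        rw [hQδ]
        gcongr
    _ = _ := by
        push_cast
        rw [ENNReal.coe_rpow_of_nonneg _ (by linarith : 0 ≤ -E),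
          ENNReal.coe_rpow_of_nonneg _ (by positivity : 0 ≤ 1 / p),
          ENNReal.coe_rpow_of_nonneg _ (by positivity : 0 ≤ 1 / p)]
        ring

end Local

/-! ### From the local estimate to the amalgam norms. -/

theorem eLpNorm_const_mul_le_of_ne_top {X : Type*} [MeasurableSpace X] {m : Measure X} {q : ℝ≥0∞}
    {c : ℝ≥0∞} (hc : c ≠ ∞) (g : X → ℝ≥0∞) :
    eLpNorm (fun x => c * g x) q m ≤ c * eLpNorm g q m := by
  lift c to ℝ≥0 using hc
  exact eLpNorm_le_mul_eLpNorm_of_ae_le_mul' (ae_of_all _ fun x => by simp) q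

theorem theorem1p7 {𝕜 : Type*} [RCLike 𝕜] (n : ℕ) (hn : 1 ≤ n)
    (p α : ℝ) (q : ℝ≥0∞) (hp : 1 < p) (hpα : p ≤ α) (hαq : ENNReal.ofReal α < q)
    (w ν μ : EuclideanSpace ℝ (Fin n) → ℝ≥0)
    (hw : IsAInftyWeight w) (hν : IsWeight ν) (hμ : IsDoublingWeight μ)
    (b : EuclideanSpace ℝ (Fin n) → 𝕜) (hb : IsBMO b)
    (hbump : ∃ r : ℝ, 1 < r ∧ OrliczBump p r w ν)
    -- `Tb` stands for `[b, 𝒯]`; its domain `D` is a linear space of locally integrable functions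
    -- that contains every integrable function with compact support
    (D : Submodule 𝕜 (EuclideanSpace ℝ (Fin n) → 𝕜))
    (hDloc : ∀ f ∈ D, LocallyIntegrable f volume)
    (hDcpt : ∀ f : EuclideanSpace ℝ (Fin n) → 𝕜,
      Integrable f volume → HasCompactSupport f → f ∈ D)
    (Tb : (EuclideanSpace ℝ (Fin n) → 𝕜) → EuclideanSpace ℝ (Fin n) → 𝕜)
    (hTb : IsSublinearOn D Tb)
    (hsize : CommutatorSizeCondition D b Tb)
    (hweak : WeakTypeBound D p w ν Tb) :
    ∃ C : ℝ≥0, ∀ f ∈ D, MemAmalgam p q α ν w μ f →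
      MemWeakAmalgam p q α w μ (Tb f) ∧
        weakAmalgamNorm p q α w μ (Tb f) ≤ C * amalgamNorm p q α ν w μ f := by
  obtain ⟨r, hr, hbump⟩ := hbump
  have hp0 : 0 < p := by linarith
  have hα0 : 0 < α := by linarith
  have hq1 : 1 ≤ q := by
    refine le_trans ?_ hαq.le
    rw [← ENNReal.ofReal_one]
    exact ENNReal.ofReal_le_ofReal (by linarith)
  -- The strict inequality `α < q` makes `E + 1 / p` positive, which drives the geometric decay.
  have hqα : q⁻¹.toReal < 1 / α := by
    have h1 : q⁻¹ < (ENNReal.ofReal α)⁻¹ := ENNReal.inv_lt_inv.2 hαq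
    have h2 : (ENNReal.ofReal α)⁻¹ ≠ ∞ := by simpa using hα0
    have h3 := (ENNReal.toReal_lt_toReal (h1.trans_le le_top).ne h2).2 h1
    rw [ENNReal.toReal_inv (ENNReal.ofReal α), ENNReal.toReal_ofReal hα0.le] at h3
    rwa [one_div]
  set E : ℝ := 1 / α - 1 / p - q⁻¹.toReal with hE
  have hE0 : E ≤ 0 := by
    have h1 : 1 / α ≤ 1 / p := one_div_le_one_div_of_le hp0 hpα
    have h2 : 0 ≤ q⁻¹.toReal := ENNReal.toReal_nonneg
    linarith
  have hE1 : 0 < E + 1 / p := by linarith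
  obtain ⟨K₁, K₂, B, ρ, hρ, hlocal⟩ := exists_weakLpNorm_indicator_le hn hp hr hw hν hbump hb
    hDloc hDcpt hTb hsize hweak hE0 hE1
  set A : ℝ≥0∞ := ∑' j, annulusCoeff n B ρ j with hA
  have hAt : A ≠ ∞ := tsum_annulusCoeff_ne_top n B hρ
  have hcoeff : ∀ j, annulusCoeff n B ρ j ≠ ∞ := fun j => ENNReal.ne_top_of_tsum_ne_top hAt j
  have hCt : (K₁ + K₂ * A : ℝ≥0∞) ≠ ∞ :=
    ENNReal.add_ne_top.2 ⟨ENNReal.coe_ne_top, ENNReal.mul_ne_top ENNReal.coe_ne_top hAt⟩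
  have main : ∀ f ∈ D, weakAmalgamNorm p q α w μ (Tb f) ≤
      (K₁ + K₂ * A) * amalgamNorm p q α ν w μ f := by
    intro f hf
    set F : ℝ → EuclideanSpace ℝ (Fin n) → ℝ≥0∞ := fun ℓ y => weightMeasure w (cube y ℓ) ^ E *
      eLpNorm ((cube y ℓ).indicator f) (ENNReal.ofReal p) (weightMeasure ν) with hF
    have hFm : ∀ ℓ, Measurable (F ℓ) := fun ℓ =>
      have : SFinite (weightMeasure w) := by unfold weightMeasure; infer_instance
      ((measurable_measure_cube (weightMeasure w) ℓ).pow_const E).mul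
        (measurable_eLpNorm_indicator_cube hp0 hν f ℓ)
    -- Every side length is admitted in the supremum, so all dilates share the bound `M`.
    have hFle : ∀ ℓ, 0 < ℓ → eLpNorm (F ℓ) q (weightMeasure μ) ≤ amalgamNorm p q α ν w μ f :=
      fun ℓ hℓ => le_iSup₂_of_le (f := fun (ℓ : ℝ) (_ : 0 < ℓ) =>
        eLpNorm (F ℓ) q (weightMeasure μ)) ℓ hℓ le_rfl
    set M := amalgamNorm p q α ν w μ f with hM
    refine iSup₂_le fun ℓ hℓ => ?_
    have hside := dilatedSide_pos hn hℓ
    set G : EuclideanSpace ℝ (Fin n) → ℝ≥0∞ := fun y =>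
      ∑' j, annulusCoeff n B ρ j * F (dilatedSide n ℓ (j + 1)) y with hG
    have hGm : Measurable G :=
      Measurable.tsum fun j => (hFm _).const_mul _
    have hGle : eLpNorm G q (weightMeasure μ) ≤ A * M := by
      refine (eLpNorm_tsum_nat_le hq1 fun j => ((hFm _).const_mul _).aemeasurable).trans ?_
      rw [hA, ← ENNReal.tsum_mul_right]
      refine ENNReal.tsum_le_tsum fun j => ?_
      refine (eLpNorm_const_mul_le_of_ne_top (hcoeff j) _).trans ?_
      gcongr
      exact hFle _ (hside _)
    calc eLpNorm (fun y => weightMeasure w (cube y ℓ) ^ E *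
          weakLpNorm p w ((cube y ℓ).indicator (Tb f))) q (weightMeasure μ)
        ≤ eLpNorm ((fun y => K₁ * F (dilatedSide n ℓ 0) y) + fun y => K₂ * G y) q
            (weightMeasure μ) := by
          -- Only the majorant has to be measurable in `y`; the weak norm on the left need not be.
          refine eLpNorm_mono_enorm fun y => ?_
          simp only [enorm_eq_self, Pi.add_apply]
          exact hlocal f hf y ℓ hℓ
      _ ≤ eLpNorm (fun y => K₁ * F (dilatedSide n ℓ 0) y) q (weightMeasure μ) +
            eLpNorm (fun y => K₂ * G y) q (weightMeasure μ) :=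
          eLpNorm_add_le ((hFm _).const_mul _).aestronglyMeasurable
            (hGm.const_mul _).aestronglyMeasurable hq1
      _ ≤ K₁ * M + K₂ * (A * M) := by
          refine add_le_add ((eLpNorm_const_mul_le_of_ne_top ENNReal.coe_ne_top _).trans ?_)
            ((eLpNorm_const_mul_le_of_ne_top ENNReal.coe_ne_top _).trans ?_)
          · gcongr
            exact hFle _ (hside 0)
          · gcongr
      _ = (K₁ + K₂ * A) * M := by ring
  refine ⟨(K₁ + K₂ * A).toNNReal, fun f hf hfm => ?_⟩
  rw [ENNReal.coe_toNNReal hCt]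
  exact ⟨⟨hTb.aestronglyMeasurable f hf,
    (main f hf).trans_lt (ENNReal.mul_lt_top hCt.lt_top hfm.2)⟩, main f hf⟩
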